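/- Let $(\Omega,\mathcal F,P)$ be a probability space with a filtration $\mathbb F=\{\mathcal F_t,\ t\in[0,1]\}$ which is left-continuous at $1$, i.e. $\sigma\big(\bigcup_{t<1}\mathcal F_t\big)=\mathcal F_1$, and let $X=\{X(t),\ t\in[0,1]\}$ be a real-valued $\mathbb F$-adapted process. Let $\tfrac12<a\le\alpha$ and assume: 1. (Hölder continuity) for almost every $\omega$ there is a finite $C=C(\omega)$ such that $|X(t)-X(s)|\le C|t-s|^{a}$ for all $s,t\in[0,1]$; 2. (small ball estimate) there are constants $\delta>0$ and $C>0$ such that for all $s\le t$ in $[1-\delta,1]\cap[0,1]$, with $\Delta=t-s$, and all $0<\epsilon\le\Delta^{\alpha}$, $$P\Big(\sup_{s\le u\le t}|X(u)-X(s)|\le\epsilon\Big)\le\exp\big(-C\Delta\epsilon^{-1/\alpha}\big).$$ For $\beta\in(0,1)$ and functions $f,g$ on $[0,t]$, put $g_{t-}=g-g(t)$ and $$D_{0+}^{\beta}f(x)=\frac1{\Gamma(1-\beta)}\Big(\frac{f(x)}{x^\beta}+\beta\int_0^x\frac{f(x)-f(u)}{(x-u)^{\beta+1}}\,du\Big),$$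 $$D_{t-}^{1-\beta}g(x)=\frac1{\Gamma(\beta)}\Big(\frac{g(x)}{(t-x)^{1-\beta}}+(1-\beta)\int_x^t\frac{g(x)-g(u)}{(u-x)^{2-\beta}}\,du\Big).$$ The generalized Lebesgue--Stieltjes integral of order $\beta$ is $$\int_0^t f\,dg=-\int_0^t \big(D_{0+}^{\beta}f\big)(x)\,\big(D_{t-}^{1-\beta}g_{t-}\big)(x)\,dx ,$$ and we say that it exists if $f$ is measurable and $$\int_0^t\Big(\frac{|f(r)|}{r^\beta}+\int_0^r\frac{|f(r)-f(s)|}{(r-s)^{\beta+1}}\,ds\Big)dr<\infty,\qquad \sup_{0\le u<v\le t}\Big(\frac{|g(v)-g(u)|}{(v-u)^{1-\beta}}+\int_u^v\frac{|g(u)-g(z)|}{(z-u)^{2-\beta}}\,dz\Big)<\infty .$$ Then for every real-valued $\mathcal F_1$-measurable random variable $\xi$ there are a constant $\beta\in(1-a,1)$ and an $\mathbb F$-adapted process $\psi$ such that, almost surely, the generalized Lebesgue--Stieltjes integral $\int_0^t\psi(s)\,dX(s)$ of order $\beta$ exists for every $t\in[0,1)$ and $$\lim_{t\to1-}\int_0^t\psi(s)\,dX(s)=\xi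 .$$ -/

import Mathlib

open MeasureTheory Filter Topology Set
open scoped ENNReal unitInterval

noncomputable section

/-- Left-sided fractional (Weyl--Marchaud) derivative `D_{a+}^β f` on an interval with
left endpoint `a`. -/
def leftFracDeriv (β a : ℝ) (f : ℝ → ℝ) (x : ℝ) : ℝ :=
  (1 / Real.Gamma (1 - β)) *
    (f x / (x - a) ^ β + β * ∫ u in a..x, (f x - f u) / (x - u) ^ (β + 1))

/-- Right-sided fractional (Weyl--Marchaud) derivative `D_{b-}^γ g` on an interval with right
endpoint `b`, without the complex phase `(-1)^γ` (see `glsIntegral`). -/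
def rightFracDeriv (γ b : ℝ) (g : ℝ → ℝ) (x : ℝ) : ℝ :=
  (1 / Real.Gamma (1 - γ)) *
    (g x / (b - x) ^ γ + γ * ∫ u in x..b, (g x - g u) / (u - x) ^ (γ + 1))

/-- The norm `‖f‖_{β;[a,b]}`, with values in `[0,∞]`. -/
def fracNorm (β a b : ℝ) (f : ℝ → ℝ) : ℝ≥0∞ :=
  ∫⁻ t in Ioo a b, (ENNReal.ofReal (|f t| / (t - a) ^ β) +
    ∫⁻ s in Ioo a t, ENNReal.ofReal (|f t - f s| / (t - s) ^ (β + 1)))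

/-- The functional `Λ_β(g)` on `[a,b]`, with values in `[0,∞]`. -/
def fracLambda (β a b : ℝ) (g : ℝ → ℝ) : ℝ≥0∞ :=
  ⨆ (u : ℝ) (v : ℝ) (_ : a ≤ u ∧ u < v ∧ v ≤ b),
    (ENNReal.ofReal (|g v - g u| / (v - u) ^ (1 - β)) +
      ∫⁻ z in Ioo u v, ENNReal.ofReal (|g u - g z| / (z - u) ^ (2 - β)))

/-- The generalized Lebesgue--Stieltjes integral `∫_a^b f dg` of order `β` exists: `f` is an
admissible integrand, `‖f‖_{β;[a,b]} < ∞`, and `Λ_β(g) < ∞`. These conditions imply that the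
integrals defining `D_{a+}^β f` converge almost everywhere, that `D_{a+}^β f ∈ L¹[a,b]` and that
`D_{b-}^{1-β} g_{b-} ∈ L^∞[a,b]`. -/
structure GLSIntegrable (β a b : ℝ) (f g : ℝ → ℝ) : Prop where
  order_pos : 0 < β
  order_lt_one : β < 1
  aemeasurable : AEMeasurable f (volume.restrict (Ioo a b))
  fracNorm_lt_top : fracNorm β a b f < ∞
  fracLambda_lt_top : fracLambda β a b g < ∞

/-- The generalized Lebesgue--Stieltjes integral
`∫_a^b f dg = (-1)^β ∫_a^b (D_{a+}^β f)(x) (D_{b-}^{1-β} g_{b-})(x) dx`, `g_{b-} = g - g(b)`.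
The phases `(-1)^β` and `(-1)^{1-β}` multiply to `-1`, which is the sign in front; with it
`∫_a^b 1 dg = g(b) - g(a)`. -/
def glsIntegral (β a b : ℝ) (f g : ℝ → ℝ) : ℝ :=
  -∫ x in a..b, leftFracDeriv β a f x * rightFracDeriv (1 - β) b (fun y => g y - g b) x

/-- A path of a process on `[0,1]`, as a function on `ℝ` (constant outside `[0,1]`). -/
def processPath {Ω : Type*} (Y : I → Ω → ℝ) (ω : Ω) : ℝ → ℝ :=
  IccExtend zero_le_one (fun t : I => Y t ω)

/-- Almost all paths of `X` are Hölder continuous of order `a` on `[0,1]`; the Hölder constant may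
depend on the path. -/
def HasHolderPaths {Ω : Type*} [MeasurableSpace Ω] (P : Measure Ω) (X : I → Ω → ℝ)
    (a : ℝ) : Prop :=
  ∀ᵐ ω ∂P, ∃ C : ℝ, ∀ s t : I, |X t ω - X s ω| ≤ C * |(t : ℝ) - s| ^ a

/-- Small ball estimate with exponent `α` near the end point `1`. The event
`sup_{s ≤ u ≤ t} |X(u) - X(s)| ≤ ε` is written out pointwise. -/
def SmallBall {Ω : Type*} [MeasurableSpace Ω] (P : Measure Ω) (X : I → Ω → ℝ)
    (α : ℝ) : Prop :=
  ∃ δ > (0 : ℝ), ∃ C > (0 : ℝ), ∀ s t : I, 1 - δ ≤ (s : ℝ) → s ≤ t →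
    ∀ ε : ℝ, 0 < ε → ε ≤ ((t : ℝ) - s) ^ α →
      P {ω | ∀ u ∈ Icc s t, |X u ω - X s ω| ≤ ε} ≤
        ENNReal.ofReal (Real.exp (-(C * ((t : ℝ) - s) * ε ^ (-(1 / α)))))

/-- The filtration is left-continuous at `1`: `σ(⋃_{t<1} 𝓕_t) = 𝓕_1`. -/
def LeftContinuousAtOne {Ω : Type*} {m : MeasurableSpace Ω} (𝓕 : Filtration I m) : Prop :=
  (⨆ (t : I) (_ : t < 1), 𝓕 t) = 𝓕 1

end

/-! Take deterministic times `T n` increasing to 1 and work block by block on [T n, T (n+1)]. Since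
a > 1/2, the sum of squared increments of a path vanishes along fine grids, so Riemann sums of 2y dy
for y = X - X(T n) are close to y². Switching the integrand off at the first grid exit of y from
(-ε, ε) and dividing by ε² gives, on a fine enough grid, a running integral of modulus at most 2,
whose value G over the whole block satisfies |G - 1| ≤ 1/2 whenever y leaves (-2ε, 2ε)
(`stoppedGain_bounds`, `block_gain_bounds`). By the small ball estimate ε = ε_n can be chosen so
that the path stays inside with probability at most 2^{-n}; by Borel–Cantelli almost every path
exits in all but finitely many blocks.

Let w_n be the integral up to `T n`, and let η_n → ξ almost surely with η_n known at time `T n`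
(`exists_adapted_approximation`). Multiplying the integrand of block n by η_n - w_n gives w_{n+1} -
ξ = (η_n - ξ) + (η_n - w_n)(G - 1), so the error is halved up to a multiple of |η_n - ξ| and tends
to 0. The bound 2 on the running integral controls the times inside a block
(`tendsto_glsIntegral_strategy`).

Before any t < 1 the integrand is a step function, so only integrals of indicators are needed. The
left derivative of the indicator of [p, ∞) is (x - p)^{-β}/Γ(1-β) for x > p, and
`integral_kernel_mul_rightFracDeriv` shows that pairing it with the right derivative yields g(t) -
g(p): by Fubini and the Beta integral for smooth g, then by Steklov averaging for Hölder g. The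
fractional integral thereby becomes a Riemann sum, and the remaining path estimates are discrete. -/

/-! ### The Beta kernel -/

theorem integral_beta_kernel {β p u : ℝ} (hβ0 : 0 < β) (hβ1 : β < 1) (hpu : p < u) :
    ∫ x in p..u, (x - p) ^ (-β) * (u - x) ^ (β - 1) = Real.Gamma (1 - β) * Real.Gamma β := by
  have hlen : 0 < u - p := sub_pos.2 hpu
  have hscaled := Complex.betaIntegral_scaled ((1 - β : ℝ) : ℂ) (β : ℂ) hlen
  have hgamma := ProbabilityTheory.beta_eq_betaIntegralReal (1 - β) β (by linarith) hβ0
  have hshift : ∫ x in p..u, (x - p) ^ (-β) * (u - x) ^ (β - 1) =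
      ∫ x in (0 : ℝ)..(u - p), x ^ (-β) * (u - p - x) ^ (β - 1) := by
    have := intervalIntegral.integral_comp_sub_right (a := p) (b := u)
      (fun x => x ^ (-β) * (u - p - x) ^ (β - 1)) p
    rw [sub_self] at this
    rw [← this]
    refine intervalIntegral.integral_congr fun x _ => ?_
    rw [show u - p - (x - p) = u - x by ring]
  have hcast : ((∫ x in (0 : ℝ)..(u - p), x ^ (-β) * (u - p - x) ^ (β - 1) : ℝ) : ℂ) =
      Complex.betaIntegral ((1 - β : ℝ) : ℂ) (β : ℂ) := by
    -- The scaling exponent of the length is zero, so the integral does not depend on `u - p`.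
    have h1 : (((u - p : ℝ) : ℂ)) ^ (((1 - β : ℝ) : ℂ) + (β : ℂ) - 1) = 1 := by
      rw [show ((1 - β : ℝ) : ℂ) + (β : ℂ) - 1 = 0 by push_cast; ring, Complex.cpow_zero]
    rw [h1, one_mul] at hscaled
    rw [← hscaled, ← intervalIntegral.integral_ofReal]
    refine intervalIntegral.integral_congr fun x hx => ?_
    rw [uIcc_of_le hlen.le] at hx
    rw [Complex.ofReal_mul, Complex.ofReal_cpow hx.1, Complex.ofReal_cpow (sub_nonneg.2 hx.2)]
    push_cast
    congr 2
    ring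
  rw [hshift]
  have := congrArg Complex.re hcast
  rw [Complex.ofReal_re, ← hgamma] at this
  rw [this, ProbabilityTheory.beta]
  simp

/-- A non-integrable function has integral 0 by convention, whereas the value found above is
positive. -/
theorem intervalIntegrable_beta_kernel {β p u : ℝ} (hβ0 : 0 < β) (hβ1 : β < 1) (hpu : p < u) :
    IntervalIntegrable (fun x => (x - p) ^ (-β) * (u - x) ^ (β - 1)) volume p u := by
  by_contra h
  have := intervalIntegral.integral_undef h
  rw [integral_beta_kernel hβ0 hβ1 hpu] at this
  have h1 := Real.Gamma_pos_of_pos hβ0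
  have h2 := Real.Gamma_pos_of_pos (show 0 < 1 - β by linarith)
  exact (mul_pos h2 h1).ne' this

theorem intervalIntegrable_sub_rpow {r : ℝ} (hr : -1 < r) (p s t : ℝ) :
    IntervalIntegrable (fun x => (x - p) ^ r) volume s t := by
  have := (intervalIntegral.intervalIntegrable_rpow' (a := s - p) (b := t - p) hr).comp_sub_right p
  simpa using this

/-! ### The right-sided fractional derivative of a smooth function -/

/-- Integration by parts with the primitive (g(u) - g(x))(u - x)^{β-1}: its value at t cancels the
boundary term of the fractional derivative. -/
theorem rightFracDeriv_of_hasDerivAt {β x t M : ℝ} {g g' : ℝ → ℝ} (hβ0 : 0 < β)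
    (hxt : x < t) (hg : ∀ y, HasDerivAt g (g' y) y) (hg' : Continuous g') (hM : ∀ y, |g' y| ≤ M) :
    rightFracDeriv (1 - β) t (fun y => g y - g t) x =
      -(1 / Real.Gamma β) * ∫ u in x..t, g' u * (u - x) ^ (β - 1) := by
  have hgc : Continuous g := continuous_iff_continuousAt.2 fun y => (hg y).continuousAt
  have hM0 : 0 ≤ M := (abs_nonneg _).trans (hM 0)
  have hlip : ∀ y z, |g y - g z| ≤ M * |y - z| := fun y z => by
    have := Convex.norm_image_sub_le_of_norm_hasDerivWithin_le (s := univ) (f := g) (f' := g')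
      (C := M) (x := z) (y := y) (fun w _ => (hg w).hasDerivWithinAt) (fun w _ => hM w)
      convex_univ (mem_univ _) (mem_univ _)
    simpa using this
  have hint1 : IntervalIntegrable (fun u => g' u * (u - x) ^ (β - 1)) volume x t :=
    (intervalIntegrable_sub_rpow (by linarith) x x t).continuousOn_mul hg'.continuousOn
  have hmeas : Measurable fun u => (g x - g u) / (u - x) ^ (1 - β + 1) := by
    have := hgc.measurable
    fun_prop
  have hint2 : IntervalIntegrable (fun u => (g x - g u) / (u - x) ^ (1 - β + 1)) volume x t := by
    refine ((intervalIntegrable_sub_rpow (r := β - 1) (by linarith) x x t).const_mul M).mono_fun'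
      hmeas.aestronglyMeasurable ?_
    rw [uIoc_of_le hxt.le]
    refine (ae_restrict_iff' measurableSet_Ioc).2 (ae_of_all _ fun u hu => ?_)
    have hpos : 0 < u - x := sub_pos.2 hu.1
    beta_reduce
    rw [Real.norm_eq_abs, abs_div, abs_of_pos (Real.rpow_pos_of_pos hpos _),
      div_le_iff₀ (Real.rpow_pos_of_pos hpos _), mul_assoc, ← Real.rpow_add hpos]
    rw [show β - 1 + (1 - β + 1) = 1 by ring, Real.rpow_one]
    calc |g x - g u| ≤ M * |x - u| := hlip x u
      _ = M * (u - x) := by rw [abs_sub_comm, abs_of_pos hpos]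
  have hftc : ∫ u in x..t, (g' u * (u - x) ^ (β - 1) +
        (1 - β) * ((g x - g u) / (u - x) ^ (1 - β + 1))) =
      (g t - g x) * (t - x) ^ (β - 1) - (g x - g x) * (x - x) ^ (β - 1) := by
    refine intervalIntegral.integral_eq_sub_of_hasDerivAt_of_le
      (f := fun u => (g u - g x) * (u - x) ^ (β - 1)) hxt.le ?_ ?_
      (hint1.add (hint2.const_mul _))
    · intro u hu
      rcases hu.1.eq_or_lt with rfl | hlt
      -- At the left end (u - x)^{β-1} is singular, but the Lipschitz bound makes the product at
      -- most M(u - x)^β.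
      · have hb : Tendsto (fun u => M * (u - x) ^ β) (𝓝[Icc x t] x) (𝓝 0) := by
          have : ContinuousAt (fun u => M * (u - x) ^ β) x := by
            refine continuousAt_const.mul (ContinuousAt.rpow_const (by fun_prop) (Or.inr hβ0.le))
          have h2 := this.tendsto
          simp only [sub_self, Real.zero_rpow hβ0.ne', mul_zero] at h2
          exact h2.mono_left nhdsWithin_le_nhds
        have : ContinuousWithinAt (fun u => (g u - g x) * (u - x) ^ (β - 1)) (Icc x t) x := by
          unfold ContinuousWithinAt
          simp only [sub_self, zero_mul]
          refine squeeze_zero_norm' ?_ hb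
          refine eventually_nhdsWithin_of_forall fun v hv => ?_
          rcases hv.1.eq_or_lt with rfl | hlt
          · simp [Real.zero_rpow hβ0.ne']
          · have hpos : 0 < v - x := sub_pos.2 hlt
            rw [Real.norm_eq_abs, abs_mul, abs_of_pos (Real.rpow_pos_of_pos hpos _)]
            calc |g v - g x| * (v - x) ^ (β - 1)
                ≤ M * |v - x| * (v - x) ^ (β - 1) := by gcongr; exact hlip v x
              _ = M * (v - x) ^ β := by
                rw [abs_of_pos hpos, mul_assoc]
                congr 1
                nth_rw 1 [← Real.rpow_one (v - x)]
                rw [← Real.rpow_add hpos]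
                congr 1; ring
        exact this
      · refine ContinuousAt.continuousWithinAt ?_
        exact (hgc.continuousAt.sub continuousAt_const).mul
          (ContinuousAt.rpow_const (by fun_prop) (Or.inl (sub_pos.2 hlt).ne'))
    · intro u hu
      have hpos : 0 < u - x := sub_pos.2 hu.1
      have hd := ((hg u).sub_const (g x)).mul
        (((hasDerivAt_id u).sub_const x).rpow_const (p := β - 1) (Or.inl hpos.ne'))
      convert! hd using 1
      rw [id, show 1 - β + 1 = -(β - 1 - 1) by ring, Real.rpow_neg hpos.le]
      field_simp
      ring
  rw [intervalIntegral.integral_add hint1 (hint2.const_mul _),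
    intervalIntegral.integral_const_mul] at hftc
  have hdiv : (g x - g t) / (t - x) ^ (1 - β) = -((g t - g x) * (t - x) ^ (β - 1)) := by
    rw [show β - 1 = -(1 - β) by ring, Real.rpow_neg (sub_pos.2 hxt).le]
    ring
  unfold rightFracDeriv
  simp only [sub_sub_sub_cancel_right, sub_sub_cancel]
  rw [hdiv]
  linear_combination (1 / Real.Gamma β) * hftc

/-- Fubini on the triangle p < x < u < t: for fixed u the integral over x is the Beta kernel, whose
value is independent of u. -/
theorem setIntegral_beta_convolution {β p t M : ℝ} {h : ℝ → ℝ} (hβ0 : 0 < β) (hβ1 : β < 1)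
    (hh : Continuous h) (hM : ∀ y, |h y| ≤ M) :
    ∫ x in Ioo p t, (x - p) ^ (-β) * ∫ u in Ioo x t, h u * (u - x) ^ (β - 1) =
      Real.Gamma (1 - β) * Real.Gamma β * ∫ u in Ioo p t, h u := by
  set k : ℝ × ℝ → ℝ := fun z => (Ioo p z.2).indicator
    (fun x => (x - p) ^ (-β) * (z.2 - x) ^ (β - 1)) z.1 with hk
  have hkmeas : Measurable k := by
    have h1 : Measurable fun z : ℝ × ℝ => (z.1 - p) ^ (-β) * (z.2 - z.1) ^ (β - 1) := by fun_prop
    have h2 : MeasurableSet {z : ℝ × ℝ | p < z.1 ∧ z.1 < z.2} :=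
      (measurableSet_lt measurable_const measurable_fst).inter
        (measurableSet_lt measurable_fst measurable_snd)
    exact h1.indicator h2
  have hkon : ∀ u ∈ Ioo p t, IntegrableOn (fun x => k (x, u)) (Ioo p t) ∧
      ∫ x in Ioo p t, k (x, u) = Real.Gamma (1 - β) * Real.Gamma β := by
    intro u hu
    have hsub : Ioo p t ∩ Ioo p u = Ioo p u := by
      rw [Ioo_inter_Ioo, max_self, min_eq_right hu.2.le]
    constructor
    · rw [IntegrableOn, hk]
      refine (integrable_indicator_iff measurableSet_Ioo).2 ?_
      rw [IntegrableOn, Measure.restrict_restrict measurableSet_Ioo, inter_comm, hsub]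
      exact (intervalIntegrable_iff_integrableOn_Ioo_of_le hu.1.le).1
        (intervalIntegrable_beta_kernel hβ0 hβ1 hu.1)
    · simp only [hk]
      rw [setIntegral_indicator measurableSet_Ioo, hsub, ← integral_Ioc_eq_integral_Ioo,
        ← intervalIntegral.integral_of_le hu.1.le, integral_beta_kernel hβ0 hβ1 hu.1]
  have hknonneg : ∀ z, 0 ≤ k z := fun z => by
    refine indicator_nonneg (fun x hx => ?_) _
    exact mul_nonneg (Real.rpow_nonneg (sub_nonneg.2 hx.1.le) _)
      (Real.rpow_nonneg (sub_nonneg.2 hx.2.le) _)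
  have hint : Integrable (Function.uncurry fun x u => h u * k (x, u))
      ((volume.restrict (Ioo p t)).prod (volume.restrict (Ioo p t))) := by
    refine (integrable_prod_iff' (Measurable.aestronglyMeasurable
      ((hh.measurable.comp measurable_snd).mul hkmeas))).2 ⟨?_, ?_⟩
    · refine (ae_restrict_iff' measurableSet_Ioo).2 (ae_of_all _ fun u hu => ?_)
      exact (hkon u hu).1.const_mul (h u)
    · refine Integrable.congr (f := fun u => |h u| * (Real.Gamma (1 - β) * Real.Gamma β)) ?_ ?_
      · refine Integrable.mul_const ?_ _
        exact Integrable.of_bound hh.abs.aestronglyMeasurable M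
          (ae_of_all _ fun u => by rw [Real.norm_eq_abs, abs_abs]; exact hM u)
      · refine (ae_restrict_iff' measurableSet_Ioo).2 (ae_of_all _ fun u hu => ?_)
        have hn : ∀ x, ‖(h ∘ (Prod.snd : ℝ × ℝ → ℝ) * k : ℝ × ℝ → ℝ) (x, u)‖ =
            |h u| * k (x, u) := fun x => by
          rw [Pi.mul_apply, norm_mul, Real.norm_eq_abs, Real.norm_eq_abs,
            abs_of_nonneg (hknonneg _), Function.comp_apply]
        simp only [hn]
        rw [integral_const_mul, (hkon u hu).2]
  have hswap := integral_integral_swap hint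
  have hright : ∫ u in Ioo p t, ∫ x in Ioo p t, h u * k (x, u) =
      Real.Gamma (1 - β) * Real.Gamma β * ∫ u in Ioo p t, h u := by
    rw [← integral_const_mul]
    refine setIntegral_congr_fun measurableSet_Ioo fun u hu => ?_
    rw [integral_const_mul, (hkon u hu).2, mul_comm]
  rw [← hright, ← hswap]
  refine setIntegral_congr_fun measurableSet_Ioo fun x hx => ?_
  rw [← integral_const_mul, ← integral_indicator measurableSet_Ioo,
    ← integral_indicator measurableSet_Ioo]
  congr 1
  ext u
  by_cases hu : u ∈ Ioo x t
  · have hu' : u ∈ Ioo p t := ⟨hx.1.trans hu.1, hu.2⟩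
    have hx' : x ∈ Ioo p u := ⟨hx.1, hu.1⟩
    simp only [indicator_of_mem hu, indicator_of_mem hu', hk, indicator_of_mem hx']
    ring
  · rw [indicator_of_notMem hu]
    by_cases hu' : u ∈ Ioo p t
    · have hx' : x ∉ Ioo p u := fun hx' => hu ⟨hx'.2, hu'.2⟩
      simp [indicator_of_mem hu', hk, indicator_of_notMem hx']
    · rw [indicator_of_notMem hu']

/-- Up to the factor 1/Γ(1-β), the kernel (x - p)^{-β} is the left derivative of the indicator of
[p, ∞), so this is the rule that such an indicator integrates to an increment, for smooth
integrators. -/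
theorem integral_kernel_mul_rightFracDeriv_of_hasDerivAt {β p t M : ℝ} {g g' : ℝ → ℝ}
    (hβ0 : 0 < β) (hβ1 : β < 1) (hpt : p ≤ t) (hg : ∀ y, HasDerivAt g (g' y) y)
    (hg' : Continuous g') (hM : ∀ y, |g' y| ≤ M) :
    ∫ x in p..t, (x - p) ^ (-β) * rightFracDeriv (1 - β) t (fun y => g y - g t) x =
      -(Real.Gamma (1 - β) * (g t - g p)) := by
  have hΓ := (Real.Gamma_pos_of_pos hβ0).ne'
  have hftc : ∫ u in Ioo p t, g' u = g t - g p := by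
    rw [← integral_Ioc_eq_integral_Ioo, ← intervalIntegral.integral_of_le hpt]
    exact intervalIntegral.integral_eq_sub_of_hasDerivAt (fun y _ => hg y)
      (hg'.intervalIntegrable _ _)
  have hconv := setIntegral_beta_convolution (p := p) (t := t) hβ0 hβ1 hg' hM
  rw [hftc] at hconv
  rw [intervalIntegral.integral_of_le hpt, integral_Ioc_eq_integral_Ioo]
  have : ∀ x ∈ Ioo p t, (x - p) ^ (-β) * rightFracDeriv (1 - β) t (fun y => g y - g t) x =
      -(1 / Real.Gamma β) *
        ((x - p) ^ (-β) * ∫ u in Ioo x t, g' u * (u - x) ^ (β - 1)) := fun x hx => by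
    rw [rightFracDeriv_of_hasDerivAt hβ0 hx.2 hg hg' hM,
      intervalIntegral.integral_of_le hx.2.le, integral_Ioc_eq_integral_Ioo]
    ring
  rw [setIntegral_congr_fun measurableSet_Ioo this, integral_const_mul, hconv]
  field_simp

/-! ### The right-sided fractional derivative of a Hölder function -/

theorem measurable_hoelder_kernel {γ : ℝ} {g : ℝ → ℝ} (hg : Measurable g) (x : ℝ) :
    Measurable fun u => (g x - g u) / (u - x) ^ γ := by
  fun_prop

theorem norm_hoelder_kernel_le {γ a C x u : ℝ} {g : ℝ → ℝ}
    (hg : ∀ y z, |g y - g z| ≤ C * |y - z| ^ a) (hxu : x < u) :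
    |(g x - g u) / (u - x) ^ γ| ≤ C * (u - x) ^ (a - γ) := by
  have hpos : 0 < u - x := sub_pos.2 hxu
  rw [abs_div, abs_of_pos (Real.rpow_pos_of_pos hpos _), Real.rpow_sub hpos, ← mul_div_assoc]
  have := hg x u
  rw [abs_sub_comm x u, abs_of_pos hpos] at this
  gcongr

theorem integral_hoelder_majorant {r x t : ℝ} (C : ℝ) (hr : -1 < r) :
    ∫ u in x..t, C * (u - x) ^ r = C * ((t - x) ^ (r + 1) / (r + 1)) := by
  rw [intervalIntegral.integral_const_mul,
    intervalIntegral.integral_comp_sub_right (fun u => u ^ r), sub_self,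
    integral_rpow (Or.inl hr), Real.zero_rpow (by linarith), sub_zero]

/-- The Hölder exponent exceeds the order γ, so the singular integral converges and both terms are
of size (t - x)^{a-γ}. -/
theorem abs_rightFracDeriv_le {γ a C x t : ℝ} {g : ℝ → ℝ} (hγ0 : 0 < γ) (hγ1 : γ < 1)
    (hγa : γ < a) (hg : ∀ y z, |g y - g z| ≤ C * |y - z| ^ a) (hxt : x < t) :
    |rightFracDeriv γ t (fun y => g y - g t) x| ≤
      1 / Real.Gamma (1 - γ) * (C * (1 + γ / (a - γ))) * (t - x) ^ (a - γ) := by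
  have hΓ := Real.Gamma_pos_of_pos (show 0 < 1 - γ by linarith)
  have h1 := norm_hoelder_kernel_le (γ := γ) hg hxt
  have h2 : |∫ u in x..t, (g x - g u) / (u - x) ^ (γ + 1)| ≤ C * ((t - x) ^ (a - γ) / (a - γ)) := by
    have hr : -1 < a - (γ + 1) := by linarith
    have h := intervalIntegral.norm_integral_le_of_norm_le
      (f := fun u => (g x - g u) / (u - x) ^ (γ + 1))
      (g := fun u => C * (u - x) ^ (a - (γ + 1))) (μ := volume) hxt.le
      (ae_of_all _ fun u hu => norm_hoelder_kernel_le hg hu.1)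
      ((intervalIntegrable_sub_rpow hr x x t).const_mul C)
    rw [integral_hoelder_majorant C hr, show a - (γ + 1) + 1 = a - γ by ring] at h
    exact h
  unfold rightFracDeriv
  simp only [sub_sub_sub_cancel_right]
  rw [abs_mul, abs_of_pos (one_div_pos.2 hΓ), mul_assoc]
  refine mul_le_mul_of_nonneg_left ?_ (one_div_pos.2 hΓ).le
  refine (abs_add_le _ _).trans ?_
  rw [abs_mul, abs_of_pos hγ0]
  calc _ ≤ C * (t - x) ^ (a - γ) + γ * (C * ((t - x) ^ (a - γ) / (a - γ))) := by gcongr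
    _ = _ := by ring

/-- For x < t the inner integral is that of a jointly measurable function cut off to x < u ≤ t,
hence measurable in x. -/
theorem aestronglyMeasurable_rightFracDeriv {γ t : ℝ} {g : ℝ → ℝ} (hg : Measurable g) :
    AEStronglyMeasurable (rightFracDeriv γ t (fun y => g y - g t)) (volume.restrict (Iio t)) := by
  have hset : MeasurableSet {z : ℝ × ℝ | z.1 < z.2 ∧ z.2 ≤ t} :=
    (measurableSet_lt measurable_fst measurable_snd).inter
      (measurableSet_le measurable_snd measurable_const)
  have hk : StronglyMeasurable ({z : ℝ × ℝ | z.1 < z.2 ∧ z.2 ≤ t}.indicator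
      fun z => (g z.1 - g z.2) / (z.2 - z.1) ^ (γ + 1)) :=
    (Measurable.indicator (by fun_prop) hset).stronglyMeasurable
  have hI := hk.integral_prod_right' (ν := volume)
  have hmain : StronglyMeasurable fun x => (1 / Real.Gamma (1 - γ)) *
      ((g x - g t) / (t - x) ^ γ + γ * ∫ u, {z : ℝ × ℝ | z.1 < z.2 ∧ z.2 ≤ t}.indicator
        (fun z => (g z.1 - g z.2) / (z.2 - z.1) ^ (γ + 1)) (x, u)) := by
    have h0 : Measurable fun x => (g x - g t) / (t - x) ^ γ := by fun_prop
    exact (h0.stronglyMeasurable.add (hI.const_mul γ)).const_mul _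
  refine hmain.aestronglyMeasurable.congr ?_
  refine (ae_restrict_iff' measurableSet_Iio).2 (ae_of_all _ fun x hx => ?_)
  unfold rightFracDeriv
  simp only [sub_sub_sub_cancel_right]
  rw [intervalIntegral.integral_of_le (le_of_lt hx), ← integral_indicator measurableSet_Ioc]
  rfl

/-! ### Steklov averages -/

theorem steklov_hasDerivAt {g : ℝ → ℝ} (hg : Continuous g) (n : ℕ) (x : ℝ) :
    HasDerivAt (fun x => (n + 1 : ℝ) * ∫ y in x..x + 1 / (n + 1), g y)
      ((n + 1 : ℝ) * (g (x + 1 / (n + 1)) - g x)) x := by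
  have hint : ∀ b c, IntervalIntegrable g volume b c := fun b c => hg.intervalIntegrable b c
  have h := fun y => intervalIntegral.integral_hasDerivAt_right (hint 0 y)
    hg.stronglyMeasurable.stronglyMeasurableAtFilter hg.continuousAt
  have h1 := ((h (x + 1 / (n + 1))).comp_add_const x (1 / (n + 1 : ℝ))).sub (h x)
  have heq : (fun x => ∫ y in x..x + 1 / (n + 1 : ℝ), g y) =
      (fun x => ∫ y in (0 : ℝ)..x + 1 / (n + 1 : ℝ), g y) - fun x => ∫ y in (0 : ℝ)..x, g y := by
    ext z
    exact (intervalIntegral.integral_interval_sub_left (hint _ _) (hint _ _)).symm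
  rw [← heq] at h1
  exact h1.const_mul _

/-- Over a fixed interval the average is a mean of translates of g, so it inherits the Hölder
constant of g for every n. This uniformity supplies the dominating functions below. -/
theorem steklov_eq {g : ℝ → ℝ} (n : ℕ) (x : ℝ) :
    (n + 1 : ℝ) * ∫ y in x..x + 1 / (n + 1), g y = ∫ y in (0 : ℝ)..1, g (x + y / (n + 1)) := by
  have := intervalIntegral.integral_comp_add_div (a := 0) (b := 1) g
    (show ((n : ℝ) + 1) ≠ 0 by positivity) x
  rw [this, smul_eq_mul]
  simp

theorem steklov_hoelder {a C : ℝ} {g : ℝ → ℝ} (hgc : Continuous g)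
    (hg : ∀ y z, |g y - g z| ≤ C * |y - z| ^ a) (n : ℕ) (x z : ℝ) :
    |(n + 1 : ℝ) * (∫ y in x..x + 1 / (n + 1), g y) -
      (n + 1 : ℝ) * ∫ y in z..z + 1 / (n + 1), g y| ≤ C * |x - z| ^ a := by
  rw [steklov_eq, steklov_eq, ← intervalIntegral.integral_sub
    ((by fun_prop : Continuous fun y => g (x + y / (n + 1))).intervalIntegrable _ _)
    ((by fun_prop : Continuous fun y => g (z + y / (n + 1))).intervalIntegrable _ _)]
  have := intervalIntegral.norm_integral_le_of_norm_le_const (a := 0) (b := 1)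
    (f := fun y => g (x + y / (n + 1)) - g (z + y / (n + 1))) (C := C * |x - z| ^ a)
    fun y _ => by
      have := hg (x + y / (n + 1)) (z + y / (n + 1))
      rwa [add_sub_add_right_eq_sub] at this
  simpa using this

theorem steklov_tendsto {g : ℝ → ℝ} (hgc : Continuous g) {a C : ℝ} (ha : 0 < a) (hC : 0 ≤ C)
    (hg : ∀ y z, |g y - g z| ≤ C * |y - z| ^ a) (x : ℝ) :
    Tendsto (fun n : ℕ => (n + 1 : ℝ) * ∫ y in x..x + 1 / (n + 1), g y) atTop (𝓝 (g x)) := by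
  have hlim : Tendsto (fun n : ℕ => C * (1 / ((n : ℝ) + 1)) ^ a) atTop (𝓝 0) := by
    have := (tendsto_one_div_add_atTop_nhds_zero_nat (𝕜 := ℝ)).rpow_const (p := a) (Or.inr ha.le)
    rw [Real.zero_rpow ha.ne'] at this
    simpa using this.const_mul C
  refine tendsto_iff_norm_sub_tendsto_zero.2 (squeeze_zero (fun _ => norm_nonneg _) (fun n => ?_)
    hlim)
  have h1 : g x = ∫ y in (0 : ℝ)..1, g x := by simp
  rw [steklov_eq, h1, ← intervalIntegral.integral_sub
    ((by fun_prop : Continuous fun y => g (x + y / (n + 1))).intervalIntegrable _ _) (by simp)]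
  have := intervalIntegral.norm_integral_le_of_norm_le_const (a := 0) (b := 1)
    (f := fun y => g (x + y / (n + 1)) - g x) (C := C * (1 / ((n : ℝ) + 1)) ^ a)
    fun y hy => by
      rw [uIoc_of_le zero_le_one] at hy
      refine (hg _ _).trans ?_
      rw [add_sub_cancel_left, abs_of_nonneg (by have := hy.1; positivity)]
      gcongr
      · exact div_nonneg hy.1.le (by positivity)
      · exact hy.2
  simpa using this

theorem continuous_of_hoelder {a C : ℝ} {g : ℝ → ℝ} (ha : 0 < a)
    (hg : ∀ y z, |g y - g z| ≤ C * |y - z| ^ a) : Continuous g := by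
  refine continuous_iff_continuousAt.2 fun x => ?_
  have hb : Tendsto (fun y => C * |y - x| ^ a) (𝓝 x) (𝓝 0) := by
    have : ContinuousAt (fun y => C * |y - x| ^ a) x :=
      continuousAt_const.mul (ContinuousAt.rpow_const (by fun_prop) (Or.inr ha.le))
    simpa [ContinuousAt, Real.zero_rpow ha.ne'] using this
  exact tendsto_iff_norm_sub_tendsto_zero.2
    (squeeze_zero (fun _ => norm_nonneg _) (fun y => hg y x) hb)

theorem tendsto_rightFracDeriv {γ a C x t : ℝ} {g : ℝ → ℝ} {G : ℕ → ℝ → ℝ}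
    (hγa : γ < a) (hG : ∀ n y z, |G n y - G n z| ≤ C * |y - z| ^ a)
    (hGc : ∀ n, Measurable (G n))
    (hlim : ∀ y, Tendsto (fun n => G n y) atTop (𝓝 (g y))) (hxt : x < t) :
    Tendsto (fun n => rightFracDeriv γ t (fun y => G n y - G n t) x) atTop
      (𝓝 (rightFracDeriv γ t (fun y => g y - g t) x)) := by
  unfold rightFracDeriv
  simp only [sub_sub_sub_cancel_right]
  refine ((((hlim x).sub (hlim t)).div_const _).add (Tendsto.const_mul _ ?_)).const_mul _
  refine intervalIntegral.tendsto_integral_filter_of_dominated_convergence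
    (fun u => C * (u - x) ^ (a - (γ + 1))) ?_ ?_ ?_ ?_
  · exact Eventually.of_forall fun n =>
      (measurable_hoelder_kernel (hGc n) x).aestronglyMeasurable
  · refine Eventually.of_forall fun n => ae_of_all _ fun u hu => ?_
    rw [uIoc_of_le hxt.le] at hu
    exact norm_hoelder_kernel_le (hG n) hu.1
  · exact (intervalIntegrable_sub_rpow (by linarith) x x t).const_mul C
  · exact ae_of_all _ fun u _ => ((hlim x).sub (hlim u)).div_const _

theorem norm_kernel_mul_rightFracDeriv_le {β a C p t x : ℝ} {g : ℝ → ℝ}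
    (hβ0 : 0 < β) (hβ1 : β < 1) (hβa : 1 - β < a) (hC : 0 ≤ C)
    (hg : ∀ y z, |g y - g z| ≤ C * |y - z| ^ a) (hx : x ∈ Ioo p t) :
    ‖(x - p) ^ (-β) * rightFracDeriv (1 - β) t (fun y => g y - g t) x‖ ≤
      (x - p) ^ (-β) * (1 / Real.Gamma (1 - (1 - β)) * (C * (1 + (1 - β) / (a - (1 - β)))) *
        (t - p) ^ (a - (1 - β))) := by
  have hpos : 0 < x - p := sub_pos.2 hx.1
  have hΓ := Real.Gamma_pos_of_pos (show 0 < 1 - (1 - β) by linarith)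
  have h2 : 0 ≤ (1 - β) / (a - (1 - β)) := div_nonneg (by linarith) (by linarith)
  rw [norm_mul, Real.norm_eq_abs, abs_of_pos (Real.rpow_pos_of_pos hpos _)]
  refine mul_le_mul_of_nonneg_left ((abs_rightFracDeriv_le (by linarith) (by linarith) hβa hg
    hx.2).trans ?_) (Real.rpow_pos_of_pos hpos _).le
  have h3 : (t - x) ^ (a - (1 - β)) ≤ (t - p) ^ (a - (1 - β)) :=
    Real.rpow_le_rpow (by linarith [hx.2]) (by linarith [hx.1]) (by linarith)
  exact mul_le_mul_of_nonneg_left h3 (by positivity)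

theorem intervalIntegrable_kernel_mul_rightFracDeriv {β a C p t : ℝ} {g : ℝ → ℝ}
    (hβ0 : 0 < β) (hβ1 : β < 1) (hβa : 1 - β < a) (hC : 0 ≤ C)
    (hg : ∀ y z, |g y - g z| ≤ C * |y - z| ^ a) (hpt : p ≤ t) :
    IntervalIntegrable (fun x => (x - p) ^ (-β) *
      rightFracDeriv (1 - β) t (fun y => g y - g t) x) volume p t := by
  have hgc := continuous_of_hoelder (by linarith) hg
  have hm : Measurable fun x : ℝ => (x - p) ^ (-β) := by fun_prop
  rw [intervalIntegrable_iff_integrableOn_Ioo_of_le hpt]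
  have hb := (intervalIntegrable_iff_integrableOn_Ioo_of_le hpt).1
    ((intervalIntegrable_sub_rpow (r := -β) (by linarith) p p t).mul_const
      (1 / Real.Gamma (1 - (1 - β)) * (C * (1 + (1 - β) / (a - (1 - β)))) *
        (t - p) ^ (a - (1 - β))))
  refine Integrable.mono' hb (hm.aestronglyMeasurable.mul
    ((aestronglyMeasurable_rightFracDeriv hgc.measurable).mono_measure
      (Measure.restrict_mono (fun x hx => hx.2) le_rfl))) ?_
  refine (ae_restrict_iff' measurableSet_Ioo).2 (ae_of_all _ fun x hx => ?_)
  exact norm_kernel_mul_rightFracDeriv_le hβ0 hβ1 hβa hC hg hx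

/-- Both sides pass to the limit along Steklov averages: they converge pointwise and share one
Hölder constant, so dominated convergence applies to the right derivatives and to the outer
integral. -/
theorem integral_kernel_mul_rightFracDeriv {β a C p t : ℝ} {g : ℝ → ℝ}
    (hβ0 : 0 < β) (hβ1 : β < 1) (hβa : 1 - β < a) (hC : 0 ≤ C)
    (hg : ∀ y z, |g y - g z| ≤ C * |y - z| ^ a) (hpt : p ≤ t) :
    ∫ x in p..t, (x - p) ^ (-β) * rightFracDeriv (1 - β) t (fun y => g y - g t) x =
      -(Real.Gamma (1 - β) * (g t - g p)) := by
  have ha : 0 < a := by linarith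
  have hgc := continuous_of_hoelder ha hg
  set G : ℕ → ℝ → ℝ := fun n x => (n + 1 : ℝ) * ∫ y in x..x + 1 / (n + 1), g y with hGdef
  have hGh : ∀ n y z, |G n y - G n z| ≤ C * |y - z| ^ a := fun n y z => steklov_hoelder hgc hg n y z
  have hGc : ∀ n, Continuous (G n) := fun n => continuous_of_hoelder ha (hGh n)
  have hGlim : ∀ y, Tendsto (fun n => G n y) atTop (𝓝 (g y)) := steklov_tendsto hgc ha hC hg
  have hval : ∀ n, ∫ x in p..t, (x - p) ^ (-β) *
      rightFracDeriv (1 - β) t (fun y => G n y - G n t) x =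
      -(Real.Gamma (1 - β) * (G n t - G n p)) := fun n => by
    refine integral_kernel_mul_rightFracDeriv_of_hasDerivAt hβ0 hβ1 hpt
      (fun y => steklov_hasDerivAt hgc n y) (by fun_prop)
      -- The derivative of the average is a difference quotient over a step 1/(n+1), which the
      -- Hölder condition bounds for each fixed n.
      (M := (n + 1 : ℝ) * (C * |1 / ((n : ℝ) + 1)| ^ a)) fun y => ?_
    have := hg (y + 1 / (n + 1)) y
    rw [add_sub_cancel_left] at this
    rw [abs_mul, abs_of_pos (by positivity : (0 : ℝ) < n + 1)]
    gcongr
  have hlim1 : Tendsto (fun n => -(Real.Gamma (1 - β) * (G n t - G n p))) atTop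
      (𝓝 (-(Real.Gamma (1 - β) * (g t - g p)))) :=
    (((hGlim t).sub (hGlim p)).const_mul _).neg
  refine tendsto_nhds_unique ?_ hlim1
  simp only [← hval]
  simp only [intervalIntegral.integral_of_le hpt, integral_Ioc_eq_integral_Ioo]
  have hb := (intervalIntegrable_iff_integrableOn_Ioo_of_le hpt).1
    ((intervalIntegrable_sub_rpow (r := -β) (by linarith) p p t).mul_const
      (1 / Real.Gamma (1 - (1 - β)) * (C * (1 + (1 - β) / (a - (1 - β)))) *
        (t - p) ^ (a - (1 - β))))
  refine tendsto_integral_of_dominated_convergence _ (fun n => ?_) hb (fun n => ?_) ?_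
  · exact ((intervalIntegrable_iff_integrableOn_Ioo_of_le hpt).1
      (intervalIntegrable_kernel_mul_rightFracDeriv hβ0 hβ1 hβa hC (hGh n)
        hpt)).aestronglyMeasurable
  · refine (ae_restrict_iff' measurableSet_Ioo).2 (ae_of_all _ fun x hx => ?_)
    exact norm_kernel_mul_rightFracDeriv_le hβ0 hβ1 hβa hC (hGh n) hx
  · refine (ae_restrict_iff' measurableSet_Ioo).2 (ae_of_all _ fun x hx => ?_)
    exact (tendsto_rightFracDeriv hβa hGh (fun n => (hGc n).measurable) hGlim hx.2).const_mul _

/-! ### Linearity of the generalized Lebesgue--Stieltjes integral -/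

theorem measurable_fracNorm_integrand {β a : ℝ} {f : ℝ → ℝ} (hf : Measurable f) :
    Measurable fun t => ENNReal.ofReal (|f t| / (t - a) ^ β) +
      ∫⁻ s in Ioo a t, ENNReal.ofReal (|f t - f s| / (t - s) ^ (β + 1)) := by
  have hset : MeasurableSet {z : ℝ × ℝ | a < z.2 ∧ z.2 < z.1} :=
    (measurableSet_lt measurable_const measurable_snd).inter
      (measurableSet_lt measurable_snd measurable_fst)
  have hk : Measurable ({z : ℝ × ℝ | a < z.2 ∧ z.2 < z.1}.indicator
      fun z => ENNReal.ofReal (|f z.1 - f z.2| / (z.1 - z.2) ^ (β + 1))) :=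
    Measurable.indicator (by fun_prop) hset
  have h1 : (fun t => ∫⁻ s in Ioo a t, ENNReal.ofReal (|f t - f s| / (t - s) ^ (β + 1))) =
      fun t => ∫⁻ s, ({z : ℝ × ℝ | a < z.2 ∧ z.2 < z.1}.indicator
        fun z => ENNReal.ofReal (|f z.1 - f z.2| / (z.1 - z.2) ^ (β + 1))) (t, s) := by
    ext t
    rw [← lintegral_indicator measurableSet_Ioo]
    rfl
  have h2 := hk.lintegral_prod_right' (ν := volume)
  rw [← h1] at h2
  have h3 : Measurable fun t => ENNReal.ofReal (|f t| / (t - a) ^ β) := by fun_prop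
  exact h3.add h2

theorem fracNorm_add_le {β a b : ℝ} {f h : ℝ → ℝ} (hf : Measurable f) :
    fracNorm β a b (f + h) ≤ fracNorm β a b f + fracNorm β a b h := by
  unfold fracNorm
  rw [← lintegral_add_left (measurable_fracNorm_integrand hf)]
  refine setLIntegral_mono' measurableSet_Ioo fun t ht => ?_
  rw [add_add_add_comm]
  gcongr
  · rw [← ENNReal.ofReal_add (div_nonneg (abs_nonneg _) (Real.rpow_nonneg (by linarith [ht.1]) _))
      (div_nonneg (abs_nonneg _) (Real.rpow_nonneg (by linarith [ht.1]) _)), ← add_div]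
    refine ENNReal.ofReal_le_ofReal ?_
    exact div_le_div_of_nonneg_right (abs_add_le _ _) (Real.rpow_nonneg (by linarith [ht.1]) _)
  · have hm : Measurable fun s => ENNReal.ofReal (|f t - f s| / (t - s) ^ (β + 1)) := by fun_prop
    rw [← lintegral_add_left hm]
    refine setLIntegral_mono' measurableSet_Ioo fun s hs => ?_
    have hpos : 0 ≤ (t - s) ^ (β + 1) := Real.rpow_nonneg (by linarith [hs.2]) _
    rw [← ENNReal.ofReal_add (div_nonneg (abs_nonneg _) hpos) (div_nonneg (abs_nonneg _) hpos),
      ← add_div]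
    refine ENNReal.ofReal_le_ofReal (div_le_div_of_nonneg_right ?_ hpos)
    simp only [Pi.add_apply]
    rw [add_sub_add_comm]
    exact abs_add_le _ _

theorem fracNorm_const_mul {β a b : ℝ} (c : ℝ) (f : ℝ → ℝ) :
    fracNorm β a b (fun x => c * f x) = ENNReal.ofReal |c| * fracNorm β a b f := by
  unfold fracNorm
  rw [← lintegral_const_mul' _ _ ENNReal.ofReal_ne_top]
  congr 1
  ext t
  rw [mul_add, ← lintegral_const_mul' _ _ ENNReal.ofReal_ne_top,
    ← ENNReal.ofReal_mul (abs_nonneg c), abs_mul, mul_div_assoc]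
  congr 2
  ext s
  rw [← ENNReal.ofReal_mul (abs_nonneg c), ← mul_sub, abs_mul, mul_div_assoc]

/-- `f` is an integrand against `g` on `[0,t]`, all the integrals involved converge, and the
generalized Lebesgue--Stieltjes integral of order `β` is `v`. -/
structure HasGLSIntegral (β t : ℝ) (f g : ℝ → ℝ) (v : ℝ) : Prop where
  measurable : Measurable f
  fracNorm_lt_top : fracNorm β 0 t f < ∞
  kernel_integrable : ∀ᵐ x ∂volume.restrict (Ioo 0 t),
    IntervalIntegrable (fun u => (f x - f u) / (x - u) ^ (β + 1)) volume 0 x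
  product_integrable : IntegrableOn (fun x => leftFracDeriv β 0 f x *
    rightFracDeriv (1 - β) t (fun y => g y - g t) x) (Ioo 0 t)
  integral_eq : -∫ x in Ioo 0 t, leftFracDeriv β 0 f x *
    rightFracDeriv (1 - β) t (fun y => g y - g t) x = v

namespace HasGLSIntegral

variable {β t v w : ℝ} {f h g : ℝ → ℝ}

theorem zero : HasGLSIntegral β t (fun _ => 0) g 0 where
  measurable := measurable_const
  fracNorm_lt_top := by simp [fracNorm]
  kernel_integrable := by simp
  product_integrable := by simp [leftFracDeriv]
  integral_eq := by simp [leftFracDeriv]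

theorem const_mul (c : ℝ) (hf : HasGLSIntegral β t f g v) :
    HasGLSIntegral β t (fun x => c * f x) g (c * v) := by
  have hD : ∀ x, leftFracDeriv β 0 (fun x => c * f x) x = c * leftFracDeriv β 0 f x := fun x => by
    unfold leftFracDeriv
    simp only [← mul_sub, mul_div_assoc, intervalIntegral.integral_const_mul]
    ring
  refine ⟨hf.measurable.const_mul c, ?_, ?_, ?_, ?_⟩
  · rw [fracNorm_const_mul]
    exact ENNReal.mul_lt_top ENNReal.ofReal_lt_top hf.fracNorm_lt_top
  · filter_upwards [hf.kernel_integrable] with x hx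
    simpa only [← mul_sub, mul_div_assoc] using hx.const_mul c
  · simp only [hD, mul_assoc]
    exact hf.product_integrable.const_mul c
  · simp only [hD, mul_assoc, integral_const_mul]
    rw [← hf.integral_eq, mul_neg]

/-- Splitting the inner integral needs both kernels to be integrable; the field `kernel_integrable`
records this for almost every x, which suffices. -/
theorem add (hf : HasGLSIntegral β t f g v) (hh : HasGLSIntegral β t h g w) :
    HasGLSIntegral β t (fun x => f x + h x) g (v + w) := by
  have hD : ∀ᵐ x ∂volume.restrict (Ioo 0 t),
      leftFracDeriv β 0 f x * rightFracDeriv (1 - β) t (fun y => g y - g t) x +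
        leftFracDeriv β 0 h x * rightFracDeriv (1 - β) t (fun y => g y - g t) x =
      leftFracDeriv β 0 (fun x => f x + h x) x *
        rightFracDeriv (1 - β) t (fun y => g y - g t) x := by
    filter_upwards [hf.kernel_integrable, hh.kernel_integrable] with x hx hx'
    unfold leftFracDeriv
    simp only [add_sub_add_comm, add_div]
    rw [intervalIntegral.integral_add hx hx']
    ring
  refine ⟨hf.measurable.add hh.measurable, ?_, ?_, ?_, ?_⟩
  · exact (fracNorm_add_le hf.measurable).trans_lt
      (ENNReal.add_lt_top.2 ⟨hf.fracNorm_lt_top, hh.fracNorm_lt_top⟩)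
  · filter_upwards [hf.kernel_integrable, hh.kernel_integrable] with x hx hx'
    simpa only [add_sub_add_comm, add_div] using hx.add hx'
  · exact (hf.product_integrable.add hh.product_integrable).congr hD
  · rw [← integral_congr_ae hD, integral_add hf.product_integrable hh.product_integrable,
      neg_add, hf.integral_eq, hh.integral_eq]

theorem sum {ι : Type*} (s : Finset ι) {F : ι → ℝ → ℝ} {V : ι → ℝ}
    (hF : ∀ i ∈ s, HasGLSIntegral β t (F i) g (V i)) :
    HasGLSIntegral β t (fun x => ∑ i ∈ s, F i x) g (∑ i ∈ s, V i) := by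
  classical
  induction s using Finset.induction_on with
  | empty => simpa using zero
  | insert i s hi ih =>
    simp only [Finset.sum_insert hi]
    exact (hF i (Finset.mem_insert_self i s)).add
      (ih fun j hj => hF j (Finset.mem_insert_of_mem hj))

/-- Only values on (0, t) enter. This allows for a process on [0,1] extended by constants, which
need not agree with the strategy formula outside [0,1). -/
theorem glsIntegral_eq_of_eqOn (ht : 0 ≤ t) (hf : HasGLSIntegral β t f g v)
    (hfh : EqOn h f (Ioo 0 t)) : glsIntegral β 0 t h g = v := by
  unfold glsIntegral
  rw [intervalIntegral.integral_of_le ht, integral_Ioc_eq_integral_Ioo, ← hf.integral_eq]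
  congr 1
  refine setIntegral_congr_fun measurableSet_Ioo fun x hx => ?_
  congr 1
  unfold leftFracDeriv
  rw [hfh hx, intervalIntegral.integral_of_le hx.1.le, intervalIntegral.integral_of_le hx.1.le]
  congr 3
  refine setIntegral_congr_fun measurableSet_Ioc fun u hu => ?_
  rw [hfh ⟨hu.1, hu.2.trans_lt hx.2⟩]

theorem glsIntegrable_of_eqOn (hβ0 : 0 < β) (hβ1 : β < 1) (hg : fracLambda β 0 t g < ∞)
    (hf : HasGLSIntegral β t f g v) (hfh : EqOn h f (Ioo 0 t)) : GLSIntegrable β 0 t h g where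
  order_pos := hβ0
  order_lt_one := hβ1
  aemeasurable := hf.measurable.aemeasurable.congr
    ((ae_restrict_iff' measurableSet_Ioo).2 (ae_of_all _ fun _ hx => (hfh hx).symm))
  fracNorm_lt_top := by
    convert! hf.fracNorm_lt_top using 1
    unfold fracNorm
    refine setLIntegral_congr_fun measurableSet_Ioo fun x hx => ?_
    rw [hfh hx]
    congr 1
    refine setLIntegral_congr_fun measurableSet_Ioo fun u hu => ?_
    rw [hfh ⟨hu.1, hu.2.trans hx.2⟩]
  fracLambda_lt_top := hg

end HasGLSIntegral

theorem fracLambda_lt_top_of_hoelder {β a C t : ℝ} {g : ℝ → ℝ} (hβa : 1 - β < a) (ht : t ≤ 1)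
    (hC : 0 ≤ C) (hg : ∀ y z, |g y - g z| ≤ C * |y - z| ^ a) : fracLambda β 0 t g < ∞ := by
  have hr : -1 < a - (2 - β) := by linarith
  have hbound : fracLambda β 0 t g ≤
      ENNReal.ofReal C + ENNReal.ofReal (C * (1 / (a - (2 - β) + 1))) := by
    unfold fracLambda
    refine iSup_le fun u => iSup_le fun v => iSup_le fun ⟨hu, huv, hv⟩ => ?_
    have hlen : 0 < v - u := sub_pos.2 huv
    -- The interval lies in [0,1], so nonnegative powers of its length are at most 1.
    have hone : ∀ s : ℝ, 0 ≤ s → (v - u) ^ s ≤ 1 := fun s hs =>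
      Real.rpow_le_one hlen.le (by linarith) hs
    gcongr
    · have := norm_hoelder_kernel_le (γ := 1 - β) hg huv
      rw [abs_div, abs_of_pos (Real.rpow_pos_of_pos hlen _), abs_sub_comm] at this
      exact this.trans (mul_le_of_le_one_right hC (hone _ (by linarith)))
    · calc ∫⁻ z in Ioo u v, ENNReal.ofReal (|g u - g z| / (z - u) ^ (2 - β))
          ≤ ∫⁻ z in Ioo u v, ENNReal.ofReal (C * (z - u) ^ (a - (2 - β))) := by
            refine setLIntegral_mono' measurableSet_Ioo fun z hz => ENNReal.ofReal_le_ofReal ?_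
            have := norm_hoelder_kernel_le (γ := 2 - β) hg hz.1
            rwa [abs_div, abs_of_pos (Real.rpow_pos_of_pos (sub_pos.2 hz.1) _)] at this
        _ = ENNReal.ofReal (∫ z in Ioo u v, C * (z - u) ^ (a - (2 - β))) := by
            rw [ofReal_integral_eq_lintegral_ofReal]
            · exact (intervalIntegrable_iff_integrableOn_Ioo_of_le huv.le).1
                ((intervalIntegrable_sub_rpow hr u u v).const_mul C)
            · refine (ae_restrict_iff' measurableSet_Ioo).2 (ae_of_all _ fun z hz => ?_)
              exact mul_nonneg hC (Real.rpow_nonneg (by linarith [hz.1]) _)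
        _ ≤ _ := by
            refine ENNReal.ofReal_le_ofReal ?_
            rw [← integral_Ioc_eq_integral_Ioo, ← intervalIntegral.integral_of_le huv.le,
              integral_hoelder_majorant C hr]
            have h1 := hone (a - (2 - β) + 1) (by linarith)
            gcongr
            linarith
  exact hbound.trans_lt (ENNReal.add_lt_top.2 ⟨ENNReal.ofReal_lt_top, ENNReal.ofReal_lt_top⟩)

/-! ### Step functions -/

/-- The kernel in the fractional derivative of the indicator of `[p,∞)`. -/
theorem heaviside_kernel {β p x : ℝ} (hβ0 : 0 < β) (hp : 0 ≤ p) (hpx : p < x) :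
    IntervalIntegrable (fun u => ((Ici p).indicator (fun _ => (1 : ℝ)) x -
      (Ici p).indicator (fun _ => (1 : ℝ)) u) / (x - u) ^ (β + 1)) volume 0 x ∧
    ∫ u in (0 : ℝ)..x, ((Ici p).indicator (fun _ => (1 : ℝ)) x -
      (Ici p).indicator (fun _ => (1 : ℝ)) u) / (x - u) ^ (β + 1) =
      ((x - p) ^ (-β) - x ^ (-β)) / β := by
  have hx : (Ici p).indicator (fun _ => (1 : ℝ)) x = 1 := indicator_of_mem hpx.le _
  have hcont : ContinuousOn (fun u => 1 / (x - u) ^ (β + 1)) (uIcc 0 p) := by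
    rw [uIcc_of_le hp]
    intro u hu
    have hpos : 0 < x - u := by linarith [hu.2]
    refine ContinuousAt.continuousWithinAt (continuousAt_const.div
      (ContinuousAt.rpow_const (by fun_prop) (Or.inl hpos.ne')) (Real.rpow_pos_of_pos hpos _).ne')
  have hval : ∫ u in (0 : ℝ)..p, 1 / (x - u) ^ (β + 1) = ((x - p) ^ (-β) - x ^ (-β)) / β := by
    rw [intervalIntegral.integral_eq_sub_of_hasDerivAt (f := fun u => (x - u) ^ (-β) / β)
      (fun u hu => ?_) hcont.intervalIntegrable]
    · rw [sub_zero]; ring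
    · rw [uIcc_of_le hp] at hu
      have hpos : 0 < x - u := by linarith [hu.2]
      convert! (((hasDerivAt_id u).const_sub x).rpow_const (p := -β) (Or.inl hpos.ne')).div_const β
        using 1
      rw [id, show -β - 1 = -(β + 1) by ring, Real.rpow_neg hpos.le]
      field_simp
  have hleft : ∀ u ∈ Ioo 0 p, 1 / (x - u) ^ (β + 1) =
      ((Ici p).indicator (fun _ => (1 : ℝ)) x -
        (Ici p).indicator (fun _ => (1 : ℝ)) u) / (x - u) ^ (β + 1) := fun u hu => by
    rw [hx, indicator_of_notMem (by simpa using hu.2), sub_zero]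
  have hright : ∀ u ∈ uIcc p x, (0 : ℝ) =
      ((Ici p).indicator (fun _ => (1 : ℝ)) x -
        (Ici p).indicator (fun _ => (1 : ℝ)) u) / (x - u) ^ (β + 1) := fun u hu => by
    rw [uIcc_of_le hpx.le] at hu
    rw [hx, indicator_of_mem (by simpa using hu.1), sub_self, zero_div]
  have hi1 : IntervalIntegrable (fun u => ((Ici p).indicator (fun _ => (1 : ℝ)) x -
      (Ici p).indicator (fun _ => (1 : ℝ)) u) / (x - u) ^ (β + 1)) volume 0 p := by
    rw [intervalIntegrable_iff_integrableOn_Ioo_of_le hp]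
    exact ((intervalIntegrable_iff_integrableOn_Ioo_of_le hp).1
      hcont.intervalIntegrable).congr_fun hleft measurableSet_Ioo
  have hi2 : IntervalIntegrable (fun u => ((Ici p).indicator (fun _ => (1 : ℝ)) x -
      (Ici p).indicator (fun _ => (1 : ℝ)) u) / (x - u) ^ (β + 1)) volume p x :=
    (intervalIntegrable_const (c := (0 : ℝ))).congr fun u hu =>
      hright u (uIoc_subset_uIcc hu)
  refine ⟨hi1.trans hi2, ?_⟩
  rw [← intervalIntegral.integral_add_adjacent_intervals hi1 hi2,
    ← intervalIntegral.integral_congr (fun u hu => hright u hu), intervalIntegral.integral_zero,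
    add_zero, ← hval, intervalIntegral.integral_of_le hp, intervalIntegral.integral_of_le hp,
    integral_Ioc_eq_integral_Ioo, integral_Ioc_eq_integral_Ioo]
  exact (setIntegral_congr_fun measurableSet_Ioo hleft).symm

theorem heaviside_kernel_of_lt {β p x u : ℝ} (hxp : x < p) (hu : u ≤ x) :
    ((Ici p).indicator (fun _ => (1 : ℝ)) x - (Ici p).indicator (fun _ => (1 : ℝ)) u) /
      (x - u) ^ (β + 1) = 0 := by
  rw [indicator_of_notMem (by simpa using hxp),
    indicator_of_notMem (by simpa using hu.trans_lt hxp), sub_zero, zero_div]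

/-- The term x^{-β} coming from f(x)/x^β cancels against the one in the kernel integral. -/
theorem leftFracDeriv_heaviside {β p x : ℝ} (hβ0 : 0 < β) (hp : 0 ≤ p)
    (hpx : p < x) : leftFracDeriv β 0 ((Ici p).indicator fun _ => (1 : ℝ)) x =
      1 / Real.Gamma (1 - β) * (x - p) ^ (-β) := by
  unfold leftFracDeriv
  rw [(heaviside_kernel hβ0 hp hpx).2, indicator_of_mem (by simpa using hpx.le), sub_zero,
    Real.rpow_neg (hp.trans hpx.le)]
  field_simp
  ring

theorem leftFracDeriv_heaviside_of_lt {β p x : ℝ} (hx : 0 ≤ x) (hxp : x < p) :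
    leftFracDeriv β 0 ((Ici p).indicator fun _ => (1 : ℝ)) x = 0 := by
  unfold leftFracDeriv
  rw [intervalIntegral.integral_congr (g := fun _ => (0 : ℝ)) fun u hu => by
      rw [uIcc_of_le hx] at hu
      exact heaviside_kernel_of_lt hxp hu.2,
    indicator_of_notMem (by simpa using hxp)]
  simp

theorem fracNorm_heaviside_lt_top {β p t : ℝ} (hβ0 : 0 < β) (hβ1 : β < 1) (hp : 0 ≤ p)
    (ht : 0 ≤ t) : fracNorm β 0 t ((Ici p).indicator fun _ => (1 : ℝ)) < ∞ := by
  -- An integrable majorant: the inner integral vanishes for r < p and equals ((r - p)^{-β} -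
  -- r^{-β})/β for r > p.
  have hint : IntegrableOn (fun r => r ^ (-β) + (1 / β) * |(r - p) ^ (-β)|) (Ioo 0 t) := by
    refine (intervalIntegrable_iff_integrableOn_Ioo_of_le ht).1 ?_
    have h1 := intervalIntegrable_sub_rpow (r := -β) (by linarith) 0 0 t
    have h2 := (intervalIntegrable_sub_rpow (r := -β) (by linarith) p 0 t).abs
    simpa using h1.add (h2.const_mul (1 / β))
  refine lt_of_le_of_lt ?_ hint.lintegral_lt_top
  unfold fracNorm
  refine setLIntegral_mono_ae' measurableSet_Ioo ?_
  filter_upwards [Measure.ae_ne volume p] with r hrp hr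
  rcases lt_or_gt_of_ne hrp with hlt | hgt
  · have h0 : ∫⁻ s in Ioo 0 r, ENNReal.ofReal (|(Ici p).indicator (fun _ => (1 : ℝ)) r -
        (Ici p).indicator (fun _ => (1 : ℝ)) s| / (r - s) ^ (β + 1)) = 0 := by
      refine setLIntegral_eq_zero measurableSet_Ioo fun s hs => ?_
      rw [indicator_of_notMem (by simpa using hlt),
        indicator_of_notMem (by simpa using hs.2.trans hlt)]
      simp
    rw [h0, indicator_of_notMem (by simpa using hlt)]
    simp
  · have hk := heaviside_kernel hβ0 hp hgt
    have hnn : ∀ s ∈ Ioo 0 r, 0 ≤ (Ici p).indicator (fun _ => (1 : ℝ)) r -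
        (Ici p).indicator (fun _ => (1 : ℝ)) s := fun s hs => by
      rw [indicator_of_mem (by simpa using hgt.le)]
      by_cases hsp : s ∈ Ici p
      · simp [indicator_of_mem hsp]
      · simp [indicator_of_notMem hsp]
    have hin : ∫⁻ s in Ioo 0 r, ENNReal.ofReal (|(Ici p).indicator (fun _ => (1 : ℝ)) r -
        (Ici p).indicator (fun _ => (1 : ℝ)) s| / (r - s) ^ (β + 1)) =
        ENNReal.ofReal (((r - p) ^ (-β) - r ^ (-β)) / β) := by
      rw [← hk.2, intervalIntegral.integral_of_le hr.1.le, integral_Ioc_eq_integral_Ioo,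
        ofReal_integral_eq_lintegral_ofReal]
      · refine setLIntegral_congr_fun measurableSet_Ioo fun s hs => ?_
        rw [abs_of_nonneg (hnn s hs)]
      · exact (intervalIntegrable_iff_integrableOn_Ioo_of_le hr.1.le).1 hk.1
      · refine (ae_restrict_iff' measurableSet_Ioo).2 (ae_of_all _ fun s hs => ?_)
        exact div_nonneg (hnn s hs) (Real.rpow_nonneg (by linarith [hs.2]) _)
    have hr0 : 0 ≤ r ^ (-β) := Real.rpow_nonneg hr.1.le _
    rw [hin, indicator_of_mem (by simpa using hgt.le), abs_one, sub_zero, one_div,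
      ← Real.rpow_neg hr.1.le, ENNReal.ofReal_add hr0 (by positivity)]
    gcongr
    rw [div_eq_inv_mul, ← one_div]
    gcongr
    exact (sub_le_self _ hr0).trans (le_abs_self _)

/-- The product of the derivatives lives on (p, t). Writing `min p t` also covers p ≥ t, where this
interval is empty. -/
theorem HasGLSIntegral.heaviside {β a C p t : ℝ} {g : ℝ → ℝ}
    (hβ0 : 0 < β) (hβ1 : β < 1) (hβa : 1 - β < a) (hC : 0 ≤ C)
    (hg : ∀ y z, |g y - g z| ≤ C * |y - z| ^ a) (hp : 0 ≤ p) (ht : 0 ≤ t) :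
    HasGLSIntegral β t ((Ici p).indicator fun _ => (1 : ℝ)) g (g t - g (min p t)) := by
  have hΓ := (Real.Gamma_pos_of_pos (show 0 < 1 - β by linarith)).ne'
  have hmul : ∀ᵐ x ∂volume.restrict (Ioo 0 t), (Ioo p t).indicator (fun x =>
      1 / Real.Gamma (1 - β) *
        ((x - p) ^ (-β) * rightFracDeriv (1 - β) t (fun y => g y - g t) x)) x =
      leftFracDeriv β 0 ((Ici p).indicator fun _ => (1 : ℝ)) x *
        rightFracDeriv (1 - β) t (fun y => g y - g t) x := by
    refine (ae_restrict_iff' measurableSet_Ioo).2 ?_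
    filter_upwards [Measure.ae_ne volume p] with x hxp hx
    rcases lt_or_gt_of_ne hxp with hlt | hgt
    · rw [leftFracDeriv_heaviside_of_lt hx.1.le hlt, zero_mul,
        indicator_of_notMem fun h => hlt.not_gt h.1]
    · rw [leftFracDeriv_heaviside hβ0 hp hgt, indicator_of_mem (show x ∈ Ioo p t from ⟨hgt, hx.2⟩),
        mul_assoc]
  have hinter : Ioo 0 t ∩ Ioo p t = Ioo p t := by
    rw [Ioo_inter_Ioo, max_eq_right hp, min_self]
  have hptI : IntegrableOn (fun x => 1 / Real.Gamma (1 - β) *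
      ((x - p) ^ (-β) * rightFracDeriv (1 - β) t (fun y => g y - g t) x)) (Ioo p t) := by
    rcases le_total p t with hpt | htp
    · exact ((intervalIntegrable_iff_integrableOn_Ioo_of_le hpt).1
        (intervalIntegrable_kernel_mul_rightFracDeriv hβ0 hβ1 hβa hC hg hpt)).const_mul _
    · simp [Ioo_eq_empty_of_le htp]
  refine ⟨measurable_const.indicator measurableSet_Ici,
    fracNorm_heaviside_lt_top hβ0 hβ1 hp ht, ?_, ?_, ?_⟩
  · refine (ae_restrict_iff' measurableSet_Ioo).2 ?_
    filter_upwards [Measure.ae_ne volume p] with x hxp hx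
    rcases lt_or_gt_of_ne hxp with hlt | hgt
    · refine (intervalIntegrable_const (c := (0 : ℝ))).congr fun u hu => ?_
      rw [uIoc_of_le hx.1.le] at hu
      exact (heaviside_kernel_of_lt hlt hu.2).symm
    · exact (heaviside_kernel hβ0 hp hgt).1
  · refine Integrable.congr ?_ hmul
    refine (integrable_indicator_iff measurableSet_Ioo).2 ?_
    rwa [IntegrableOn, Measure.restrict_restrict measurableSet_Ioo, inter_comm, hinter]
  · rw [← integral_congr_ae hmul, setIntegral_indicator measurableSet_Ioo, hinter]
    rcases le_total p t with hpt | htp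
    · rw [integral_const_mul, ← integral_Ioc_eq_integral_Ioo,
        ← intervalIntegral.integral_of_le hpt,
        integral_kernel_mul_rightFracDeriv hβ0 hβ1 hβa hC hg hpt, min_eq_left hpt]
      field_simp
    · simp [Ioo_eq_empty_of_le htp, min_eq_right htp]

theorem HasGLSIntegral.indicator_Ico {β a C p q t : ℝ} {g : ℝ → ℝ}
    (hβ0 : 0 < β) (hβ1 : β < 1) (hβa : 1 - β < a) (hC : 0 ≤ C)
    (hg : ∀ y z, |g y - g z| ≤ C * |y - z| ^ a) (hp : 0 ≤ p) (hpq : p ≤ q) (ht : 0 ≤ t) :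
    HasGLSIntegral β t ((Ico p q).indicator fun _ => (1 : ℝ)) g (g (min q t) - g (min p t)) := by
  have h := (HasGLSIntegral.heaviside hβ0 hβ1 hβa hC hg hp ht).add
    ((HasGLSIntegral.heaviside hβ0 hβ1 hβa hC hg (hp.trans hpq) ht).const_mul (-1))
  convert! h using 1
  · ext x
    simp only [indicator, mem_Ico, mem_Ici]
    split_ifs <;> simp_all <;> linarith
  · ring

/-! ### Discrete integration of `2 y dy` up to the exit from `(-ε, ε)` -/

open Classical in
/-- The integrand `2 y` along a sequence, switched off once the sequence has left `(-ε, ε)`. -/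
noncomputable def stoppedCoeff (ε : ℝ) (y : ℕ → ℝ) (k : ℕ) : ℝ :=
  if ∀ j ≤ k, |y j| < ε then 2 * y k else 0

/-- The discrete integral of `stoppedCoeff` against the sequence itself. -/
noncomputable def stoppedGain (ε : ℝ) (y : ℕ → ℝ) (n : ℕ) : ℝ :=
  ∑ k ∈ Finset.range n, stoppedCoeff ε y k * (y (k + 1) - y k)

/-- The coefficient looks only at the past, which lets a path be replaced by its stopped version. -/
theorem stoppedCoeff_congr {ε : ℝ} {y z : ℕ → ℝ} {k : ℕ} (h : ∀ j ≤ k, y j = z j) :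
    stoppedCoeff ε y k = stoppedCoeff ε z k := by
  unfold stoppedCoeff
  rw [h k le_rfl]
  congr 1
  exact propext (forall₂_congr fun j hj => by rw [h j hj])

/-- Telescoping of 2y Δy = Δ(y²) - (Δy)². -/
theorem stoppedGain_eq {ε : ℝ} {y : ℕ → ℝ} (h0 : y 0 = 0) {n : ℕ} (hn : ∀ j < n, |y j| < ε) :
    stoppedGain ε y n = y n ^ 2 - ∑ k ∈ Finset.range n, (y (k + 1) - y k) ^ 2 := by
  induction n with
  | zero => simp [stoppedGain, h0]
  | succ n ih =>
    have hc : stoppedCoeff ε y n = 2 * y n := if_pos fun j hj => hn j (Nat.lt_succ_of_le hj)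
    rw [stoppedGain, Finset.sum_range_succ, ← stoppedGain,
      ih fun j hj => hn j (hj.trans n.lt_succ_self),
      Finset.sum_range_succ, hc]
    ring

/-- K is the first exit index, or n if there was no exit before n; after K the coefficients vanish
and the gain is frozen. -/
theorem exists_stoppedGain_eq (ε : ℝ) (y : ℕ → ℝ) (n : ℕ) :
    ∃ K ≤ n, (∀ j < K, |y j| < ε) ∧ stoppedGain ε y n = stoppedGain ε y K ∧
      (K = n ∨ ε ≤ |y K|) := by
  induction n with
  | zero => exact ⟨0, le_rfl, by simp, rfl, Or.inl rfl⟩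
  | succ n ih =>
    obtain ⟨K, hKn, hK, hgain, hcase⟩ := ih
    by_cases hhit : ε ≤ |y K|
    · refine ⟨K, hKn.trans n.le_succ, hK, ?_, Or.inr hhit⟩
      have hc : stoppedCoeff ε y n = 0 := if_neg fun h => (h K hKn).not_ge hhit
      rw [stoppedGain, Finset.sum_range_succ, ← stoppedGain, hc, zero_mul, add_zero, hgain]
    · obtain rfl : K = n := hcase.resolve_right hhit
      refine ⟨K + 1, le_rfl, fun j hj => ?_, rfl, Or.inl rfl⟩
      rcases Nat.lt_succ_iff_lt_or_eq.1 hj with h | rfl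
      · exact hK j h
      · exact not_le.1 hhit

/-- Up to K the gain is y_K² minus the sum of squared increments. The overshoot at exit is at most
κ, costing 2εκ + κ² in the square, and the squared increments cost at most Nκ²; `hsmall` bounds the
total by ε²/2. -/
theorem stoppedGain_bounds {ε κ : ℝ} {y : ℕ → ℝ} {N : ℕ} (hε : 0 < ε) (hκ : 0 ≤ κ) (h0 : y 0 = 0)
    (hy : ∀ k < N, |y (k + 1) - y k| ≤ κ)
    (hsmall : 2 * ε * κ + κ ^ 2 + N * κ ^ 2 ≤ ε ^ 2 / 2) :
    |stoppedGain ε y N| ≤ 2 * ε ^ 2 ∧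
      ((∃ k ≤ N, ε ≤ |y k|) → |stoppedGain ε y N - ε ^ 2| ≤ ε ^ 2 / 2) := by
  obtain ⟨K, hKN, hK, hgain, hcase⟩ := exists_stoppedGain_eq ε y N
  have hsum0 : 0 ≤ ∑ k ∈ Finset.range K, (y (k + 1) - y k) ^ 2 :=
    Finset.sum_nonneg fun _ _ => sq_nonneg _
  have hsum : ∑ k ∈ Finset.range K, (y (k + 1) - y k) ^ 2 ≤ N * κ ^ 2 := by
    calc ∑ k ∈ Finset.range K, (y (k + 1) - y k) ^ 2 ≤ ∑ _k ∈ Finset.range K, κ ^ 2 :=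
          Finset.sum_le_sum fun k hk => by
            rw [← sq_abs]
            exact pow_le_pow_left₀ (abs_nonneg _) (hy k ((Finset.mem_range.1 hk).trans_le hKN)) 2
      _ = K * κ ^ 2 := by simp
      _ ≤ N * κ ^ 2 := by gcongr
  have hyK : |y K| ≤ ε + κ := by
    rcases K with _ | m
    · rw [h0, abs_zero]; positivity
    · have h1 := hy m hKN
      have h2 := hK m m.lt_succ_self
      calc |y (m + 1)| = |y m + (y (m + 1) - y m)| := by ring_nf
        _ ≤ |y m| + |y (m + 1) - y m| := abs_add_le _ _
        _ ≤ ε + κ := by linarith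
  have hsq : y K ^ 2 ≤ (ε + κ) ^ 2 := by
    rw [← sq_abs]
    exact pow_le_pow_left₀ (abs_nonneg _) hyK 2
  rw [hgain, stoppedGain_eq h0 hK]
  constructor
  · rw [abs_le]
    constructor <;> nlinarith [sq_nonneg (y K), sq_nonneg κ, mul_nonneg hε.le hκ]
  · rintro ⟨k, hkN, hk⟩
    have hhit : ε ≤ |y K| := by
      rcases hcase with rfl | h
      · rcases hkN.eq_or_lt with rfl | hlt
        · exact hk
        · exact absurd hk (hK k hlt).not_ge
      · exact h
    have hsq' : ε ^ 2 ≤ y K ^ 2 := by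
      rw [← sq_abs (y K)]
      exact pow_le_pow_left₀ hε.le hhit 2
    rw [abs_le]
    constructor <;> nlinarith [sq_nonneg κ, mul_nonneg hε.le hκ]

theorem tendsto_zero_of_halving {e r : ℕ → ℝ} (he : ∀ n, 0 ≤ e n)
    (hr : Tendsto r atTop (𝓝 0)) (h : ∀ᶠ n in atTop, e (n + 1) ≤ e n / 2 + r n) :
    Tendsto e atTop (𝓝 0) := by
  refine tendsto_order.2 ⟨fun b hb => Eventually.of_forall fun n => hb.trans_le (he n),
    fun b hb => ?_⟩
  obtain ⟨n₀, hn₀⟩ := eventually_atTop.1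
    (h.and (hr.eventually_lt_const (by positivity : 0 < b / 4)))
  -- `b / 2` is the fixed point of s ↦ s/2 + b/4, and the distance to it halves at each step.
  have hk : ∀ k, e (n₀ + k) ≤ b / 2 + e n₀ * (1 / 2) ^ k := fun k => by
    induction k with
    | zero => simp; linarith
    | succ k ih =>
      obtain ⟨h1, h2⟩ := hn₀ (n₀ + k) (Nat.le_add_right _ _)
      rw [← add_assoc, pow_succ]
      linarith
  have hlim : Tendsto (fun k => b / 2 + e n₀ * (1 / 2 : ℝ) ^ k) atTop (𝓝 (b / 2 + e n₀ * 0)) :=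
    ((tendsto_pow_atTop_nhds_zero_of_lt_one (by norm_num) (by norm_num)).const_mul _).const_add _
  obtain ⟨k₀, hk₀⟩ := eventually_atTop.1 (hlim.eventually_lt_const (u := b) (by linarith))
  refine eventually_atTop.2 ⟨n₀ + k₀, fun n hn => ?_⟩
  obtain ⟨k, rfl⟩ := Nat.exists_eq_add_of_le ((Nat.le_add_right n₀ k₀).trans hn)
  exact (hk k).trans_lt (hk₀ k (by omega))

/-! ### The strategy along a path -/

/-- The `k`-th of `N n` equidistant points in `[T n, T (n + 1)]`. -/
noncomputable def gridPoint (T : ℕ → ℝ) (N : ℕ → ℕ) (n k : ℕ) : ℝ :=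
  T n + k / N n * (T (n + 1) - T n)

/-- Increments of the path `x` from `T n` to the grid points of the `n`-th block. -/
noncomputable def blockPath (T : ℕ → ℝ) (N : ℕ → ℕ) (x : ℝ → ℝ) (n k : ℕ) : ℝ :=
  x (gridPoint T N n k) - x (T n)

/-- The value of the integral at time `T n`. In the `n`-th block one aims at the target `η n`. -/
noncomputable def wealth (T : ℕ → ℝ) (N : ℕ → ℕ) (ε η : ℕ → ℝ) (x : ℝ → ℝ) : ℕ → ℝ
  | 0 => 0
  | n + 1 => wealth T N ε η x n + (η n - wealth T N ε η x n) *
      (stoppedGain (ε n) (blockPath T N x n) (N n) / ε n ^ 2)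

/-- The normalized integrand in the `n`-th block. -/
noncomputable def blockStrategy (T : ℕ → ℝ) (N : ℕ → ℕ) (ε : ℕ → ℝ) (x : ℝ → ℝ) (n : ℕ)
    (u : ℝ) : ℝ :=
  ∑ k ∈ Finset.range (N n), stoppedCoeff (ε n) (blockPath T N x n) k / ε n ^ 2 *
    (Ico (gridPoint T N n k) (gridPoint T N n (k + 1))).indicator (fun _ => 1) u

/-- The integrand whose integrals approach the limit of the targets `η`. -/
noncomputable def strategy (T : ℕ → ℝ) (N : ℕ → ℕ) (ε η : ℕ → ℝ) (x : ℝ → ℝ) (u : ℝ) : ℝ :=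
  ∑' n, (η n - wealth T N ε η x n) * blockStrategy T N ε x n u

section Strategy

variable {T : ℕ → ℝ} {N : ℕ → ℕ} {ε η : ℕ → ℝ} {x : ℝ → ℝ}

theorem gridPoint_zero (n : ℕ) : gridPoint T N n 0 = T n := by simp [gridPoint]

theorem gridPoint_last (hN : ∀ n, 0 < N n) (n : ℕ) : gridPoint T N n (N n) = T (n + 1) := by
  have : (N n : ℝ) ≠ 0 := by exact_mod_cast (hN n).ne'
  rw [gridPoint, div_self this]
  ring

theorem gridPoint_mono (hT : Monotone T) (n : ℕ) : Monotone (gridPoint T N n) := fun j k hjk => by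
  unfold gridPoint
  have := hT n.le_succ
  have h : 0 ≤ T (n + 1) - T n := sub_nonneg.2 this
  gcongr

theorem le_gridPoint (hT : Monotone T) (n k : ℕ) : T n ≤ gridPoint T N n k := by
  rw [← gridPoint_zero (T := T) (N := N) n]
  exact gridPoint_mono hT n (Nat.zero_le k)

theorem gridPoint_le (hT : Monotone T) (hN : ∀ n, 0 < N n) {n k : ℕ} (hk : k ≤ N n) :
    gridPoint T N n k ≤ T (n + 1) := by
  rw [← gridPoint_last (T := T) hN n]
  exact gridPoint_mono hT n hk

theorem gridPoint_succ_sub (n k : ℕ) :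
    gridPoint T N n (k + 1) - gridPoint T N n k = (T (n + 1) - T n) / N n := by
  unfold gridPoint
  push_cast
  ring

theorem blockStrategy_eq_zero (hT : Monotone T) {n m : ℕ} (hnm : m ≤ n) {u : ℝ} (hu : u < T m) :
    blockStrategy T N ε x n u = 0 := by
  refine Finset.sum_eq_zero fun k _ => ?_
  rw [indicator_of_notMem, mul_zero]
  exact fun h => (hu.trans_le ((hT hnm).trans (le_gridPoint hT n k))).not_ge h.1

theorem strategy_eq_sum (hT : Monotone T) {m : ℕ} {u : ℝ} (hu : u < T m) :
    strategy T N ε η x u = ∑ n ∈ Finset.range m,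
      (η n - wealth T N ε η x n) * blockStrategy T N ε x n u := by
  refine tsum_eq_sum fun n hn => ?_
  rw [blockStrategy_eq_zero hT (by simpa using hn) hu, mul_zero]

/-- The path of the `n`-th block, stopped at time `t`. -/
noncomputable def stoppedBlockPath (T : ℕ → ℝ) (N : ℕ → ℕ) (x : ℝ → ℝ) (t : ℝ) (n k : ℕ) : ℝ :=
  x (min (gridPoint T N n k) t) - x (T n)

/-- Stopping the path at t changes nothing at grid points before t and kills the increments after t,
so the integral up to t is the discrete gain of the stopped path. -/
theorem hasGLSIntegral_blockStrategy {β a C t : ℝ} (hβ0 : 0 < β) (hβ1 : β < 1) (hβa : 1 - β < a)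
    (hC : 0 ≤ C) (hx : ∀ y z, |x y - x z| ≤ C * |y - z| ^ a) (hT : Monotone T) (hT0 : 0 ≤ T 0)
    (ht : 0 ≤ t) (n : ℕ) :
    HasGLSIntegral β t (blockStrategy T N ε x n) x
      (stoppedGain (ε n) (stoppedBlockPath T N x t n) (N n) / ε n ^ 2) := by
  have h := HasGLSIntegral.sum (Finset.range (N n)) fun k _ =>
    (HasGLSIntegral.indicator_Ico (p := gridPoint T N n k) (q := gridPoint T N n (k + 1))
      hβ0 hβ1 hβa hC hx (hT0.trans ((hT n.zero_le).trans (le_gridPoint hT n k)))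
      (gridPoint_mono hT n k.le_succ) ht).const_mul
        (stoppedCoeff (ε n) (blockPath T N x n) k / ε n ^ 2)
  convert! h using 1
  rw [stoppedGain, Finset.sum_div]
  refine Finset.sum_congr rfl fun k _ => ?_
  unfold stoppedBlockPath
  rw [sub_sub_sub_cancel_right, div_mul_eq_mul_div]
  congr 1
  rcases le_total (gridPoint T N n k) t with hkt | htk
  · congr 1
    refine stoppedCoeff_congr fun j hj => ?_
    rw [blockPath, min_eq_left ((gridPoint_mono hT n hj).trans hkt)]
  · rw [min_eq_right htk, min_eq_right (htk.trans (gridPoint_mono hT n k.le_succ)), sub_self,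
      mul_zero, mul_zero]

theorem stoppedGain_stoppedBlockPath_of_le (hT : Monotone T) (hN : ∀ n, 0 < N n) {t : ℝ} {n : ℕ}
    (ht : T (n + 1) ≤ t) : stoppedGain (ε n) (stoppedBlockPath T N x t n) (N n) =
      stoppedGain (ε n) (blockPath T N x n) (N n) := by
  have heq : ∀ k ≤ N n, stoppedBlockPath T N x t n k = blockPath T N x n k := fun k hk => by
    rw [stoppedBlockPath, blockPath, min_eq_left ((gridPoint_le hT hN hk).trans ht)]
  refine Finset.sum_congr rfl fun k hk => ?_
  have hk := Finset.mem_range.1 hk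
  rw [heq k hk.le, heq (k + 1) hk, stoppedCoeff_congr fun j hj => heq j (hj.trans hk.le)]

theorem wealth_eq_sum (m : ℕ) : wealth T N ε η x m = ∑ n ∈ Finset.range m,
    (η n - wealth T N ε η x n) * (stoppedGain (ε n) (blockPath T N x n) (N n) / ε n ^ 2) := by
  induction m with
  | zero => rfl
  | succ m ih => rw [Finset.sum_range_succ, ← ih, wealth]

theorem hasGLSIntegral_strategy {β a C t : ℝ} (hβ0 : 0 < β) (hβ1 : β < 1) (hβa : 1 - β < a)
    (hC : 0 ≤ C) (hx : ∀ y z, |x y - x z| ≤ C * |y - z| ^ a) (hT : Monotone T) (hT0 : 0 ≤ T 0)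
    (ht : 0 ≤ t) (m : ℕ) :
    HasGLSIntegral β t (fun u => ∑ n ∈ Finset.range m,
        (η n - wealth T N ε η x n) * blockStrategy T N ε x n u) x
      (∑ n ∈ Finset.range m, (η n - wealth T N ε η x n) *
        (stoppedGain (ε n) (stoppedBlockPath T N x t n) (N n) / ε n ^ 2)) :=
  HasGLSIntegral.sum _ fun n _ =>
    (hasGLSIntegral_blockStrategy hβ0 hβ1 hβa hC hx hT hT0 ht n).const_mul _

/-- At time t the blocks before m are complete and sum to the wealth at `T m`; only block m
contributes a partial gain. -/
theorem glsIntegral_strategy {β a C t : ℝ} {h : ℝ → ℝ} (hβ0 : 0 < β) (hβ1 : β < 1)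
    (hβa : 1 - β < a) (hC : 0 ≤ C) (hx : ∀ y z, |x y - x z| ≤ C * |y - z| ^ a) (hT : Monotone T)
    (hT0 : 0 ≤ T 0) (hN : ∀ n, 0 < N n) (hh : EqOn h (strategy T N ε η x) (Ico 0 1))
    {m : ℕ} (ht : t ∈ Icc (T m) (T (m + 1))) (ht1 : t < 1) :
    glsIntegral β 0 t h x = wealth T N ε η x m + (η m - wealth T N ε η x m) *
      (stoppedGain (ε m) (stoppedBlockPath T N x t m) (N m) / ε m ^ 2) := by
  have ht0 : 0 ≤ t := hT0.trans ((hT m.zero_le).trans ht.1)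
  rw [(hasGLSIntegral_strategy hβ0 hβ1 hβa hC hx hT hT0 ht0 (m + 1)).glsIntegral_eq_of_eqOn ht0
    fun u hu => (hh ⟨hu.1.le, hu.2.trans ht1⟩).trans (strategy_eq_sum hT (hu.2.trans_le ht.2)),
    Finset.sum_range_succ, wealth_eq_sum m]
  congr 1
  refine Finset.sum_congr rfl fun n hn => ?_
  rw [stoppedGain_stoppedBlockPath_of_le hT hN
    ((hT (Finset.mem_range.1 hn : n + 1 ≤ m)).trans ht.1)]

theorem exists_block (hTlim : Tendsto T atTop (𝓝 1)) {t : ℝ} (ht : t ∈ Ico (T 0) 1) :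
    ∃ m, t ∈ Ico (T m) (T (m + 1)) := by
  have hex : ∃ m, t < T m := (hTlim.eventually_const_lt ht.2).exists
  classical
  have hne : Nat.find hex ≠ 0 := fun h => by
    have := Nat.find_spec hex
    rw [h] at this
    exact this.not_ge ht.1
  obtain ⟨m, hm⟩ := Nat.exists_eq_succ_of_ne_zero hne
  refine ⟨m, not_lt.1 (Nat.find_min hex (by omega)), ?_⟩
  have := Nat.find_spec hex
  rwa [hm] at this

theorem glsIntegrable_strategy {β a C t : ℝ} {h : ℝ → ℝ} (hβ0 : 0 < β) (hβ1 : β < 1)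
    (hβa : 1 - β < a) (hC : 0 ≤ C) (hx : ∀ y z, |x y - x z| ≤ C * |y - z| ^ a) (hT : Monotone T)
    (hT0 : 0 ≤ T 0) (hTlim : Tendsto T atTop (𝓝 1))
    (hh : EqOn h (strategy T N ε η x) (Ico 0 1)) (ht : t ∈ Ico (0 : ℝ) 1) :
    GLSIntegrable β 0 t h x := by
  obtain ⟨m, hm⟩ : ∃ m, t < T m := (hTlim.eventually_const_lt ht.2).exists
  exact (hasGLSIntegral_strategy hβ0 hβ1 hβa hC hx hT hT0 ht.1 m).glsIntegrable_of_eqOn hβ0 hβ1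
    (fracLambda_lt_top_of_hoelder hβa ht.2.le hC hx)
    fun u hu => (hh ⟨hu.1.le, hu.2.trans ht.2⟩).trans (strategy_eq_sum hT (hu.2.trans hm))

/-- In a block with a fine grid the normalized gain is bounded, and close to `1` at the end if the
path has left `(-2ε, 2ε)`. -/
theorem block_gain_bounds {a C K : ℝ} (ha : 0 < a) (hx : ∀ y z, |x y - x z| ≤ C * |y - z| ^ a)
    (hC : 0 ≤ C) (hCK : C ≤ K) (hT : Monotone T) (hN : ∀ n, 0 < N n) {n : ℕ} (hε : 0 < ε n)
    (hsmall : 2 * ε n * (K * ((T (n + 1) - T n) / N n) ^ a) +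
      (K * ((T (n + 1) - T n) / N n) ^ a) ^ 2 +
      N n * (K * ((T (n + 1) - T n) / N n) ^ a) ^ 2 ≤ ε n ^ 2 / 2)
    {t : ℝ} (ht : T n ≤ t) :
    |stoppedGain (ε n) (stoppedBlockPath T N x t n) (N n) / ε n ^ 2| ≤ 2 ∧
      ((∃ u ∈ Icc (T n) (T (n + 1)), 2 * ε n < |x u - x (T n)|) →
        |stoppedGain (ε n) (blockPath T N x n) (N n) / ε n ^ 2 - 1| ≤ 1 / 2) := by
  set L := (T (n + 1) - T n) / N n with hL
  have hL0 : 0 ≤ L := div_nonneg (sub_nonneg.2 (hT n.le_succ)) (Nat.cast_nonneg _)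
  set κ := K * L ^ a with hκ
  have hκ0 : 0 ≤ κ := mul_nonneg (hC.trans hCK) (Real.rpow_nonneg hL0 _)
  have hε2 : 0 < ε n ^ 2 := by positivity
  have hclose : ∀ y z, |y - z| ≤ L → |x y - x z| ≤ κ := fun y z hyz =>
    (hx y z).trans (mul_le_mul hCK (Real.rpow_le_rpow (abs_nonneg _) hyz ha.le)
      (Real.rpow_nonneg (abs_nonneg _) _) (hC.trans hCK))
  have hstep : ∀ k, |stoppedBlockPath T N x t n (k + 1) - stoppedBlockPath T N x t n k| ≤ κ := by
    intro k
    unfold stoppedBlockPath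
    rw [sub_sub_sub_cancel_right]
    refine hclose _ _ ((abs_min_sub_min_le_max _ _ _ _).trans ?_)
    rw [gridPoint_succ_sub, sub_self, abs_zero, ← hL, abs_of_nonneg hL0, max_eq_left hL0]
  have hstep' : ∀ k, |blockPath T N x n (k + 1) - blockPath T N x n k| ≤ κ := by
    intro k
    unfold blockPath
    rw [sub_sub_sub_cancel_right]
    refine hclose _ _ ?_
    rw [gridPoint_succ_sub, ← hL, abs_of_nonneg hL0]
  constructor
  · have h := (stoppedGain_bounds hε hκ0 (by simp [stoppedBlockPath, gridPoint_zero, ht])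
      (fun k _ => hstep k) hsmall).1
    rwa [abs_div, abs_of_pos hε2, div_le_iff₀ hε2]
  · rintro ⟨u, hu, hbig⟩
    have h := (stoppedGain_bounds (y := blockPath T N x n) (N := N n) hε hκ0
      (by simp [blockPath, gridPoint_zero]) (fun k _ => hstep' k) hsmall).2 ?_
    · have : stoppedGain (ε n) (blockPath T N x n) (N n) / ε n ^ 2 - 1 =
          (stoppedGain (ε n) (blockPath T N x n) (N n) - ε n ^ 2) / ε n ^ 2 := by
        field_simp
      rw [this, abs_div, abs_of_pos hε2, div_le_iff₀ hε2]
      linarith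
    · have hκε : κ ≤ ε n := by
        nlinarith [sq_nonneg κ, mul_nonneg (Nat.cast_nonneg (N n)) (sq_nonneg κ)]
      obtain ⟨k, hkN, hk⟩ : ∃ k ≤ N n, |u - gridPoint T N n k| ≤ L := by
        classical
        have hex : ∃ k, u ≤ gridPoint T N n k := ⟨N n, by rw [gridPoint_last hN]; exact hu.2⟩
        refine ⟨Nat.find hex, Nat.find_min' hex (by rw [gridPoint_last hN]; exact hu.2), ?_⟩
        have hspec := Nat.find_spec hex
        rw [abs_sub_comm, abs_of_nonneg (sub_nonneg.2 hspec)]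
        rcases Nat.eq_zero_or_eq_succ_pred (Nat.find hex) with h0 | hs
        · rw [h0, gridPoint_zero]
          linarith [hu.1]
        · have hlt := not_le.1 (Nat.find_min hex (m := (Nat.find hex).pred) (by omega))
          have := gridPoint_succ_sub (T := T) (N := N) n (Nat.find hex).pred
          rw [hs, Nat.succ_eq_add_one]
          linarith
      refine ⟨k, hkN, ?_⟩
      have h1 := hclose _ _ hk
      have h2 : |x u - x (T n)| ≤ |x u - x (gridPoint T N n k)| + |blockPath T N x n k| := by
        unfold blockPath
        exact abs_sub_le _ _ _
      linarith

theorem tendsto_glsIntegral_strategy {β a C ξ : ℝ} {h : ℝ → ℝ} (hβ0 : 0 < β) (hβ1 : β < 1)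
    (hβa : 1 - β < a) (hC : 0 ≤ C) (hx : ∀ y z, |x y - x z| ≤ C * |y - z| ^ a) (hT : Monotone T)
    (hT0 : 0 ≤ T 0) (hT1 : ∀ n, T n < 1) (hTlim : Tendsto T atTop (𝓝 1)) (hN : ∀ n, 0 < N n)
    (hε : ∀ n, 0 < ε n)
    (hsmall : ∀ n : ℕ, 2 * ε n * (n * ((T (n + 1) - T n) / N n) ^ a) +
      (n * ((T (n + 1) - T n) / N n) ^ a) ^ 2 +
      N n * (n * ((T (n + 1) - T n) / N n) ^ a) ^ 2 ≤ ε n ^ 2 / 2)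
    (hexit : ∀ᶠ n in atTop, ∃ u ∈ Icc (T n) (T (n + 1)), 2 * ε n < |x u - x (T n)|)
    (hη : Tendsto η atTop (𝓝 ξ)) (hh : EqOn h (strategy T N ε η x) (Ico 0 1)) :
    Tendsto (fun t => glsIntegral β 0 t h x) (𝓝[<] 1) (𝓝 ξ) := by
  have ha : 0 < a := by linarith
  -- The grid of block n is built for the Hölder constant n, so the deterministic grids suit each
  -- path from some block on.
  have hCn : ∀ᶠ n : ℕ in atTop, C ≤ n := tendsto_natCast_atTop_atTop.eventually_ge_atTop C
  have hη0 : Tendsto (fun n => |η n - ξ|) atTop (𝓝 0) := tendsto_iff_norm_sub_tendsto_zero.1 hη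
  set w := wealth T N ε η x with hw
  have hw0 : Tendsto (fun n => |w n - ξ|) atTop (𝓝 0) := by
    refine tendsto_zero_of_halving (fun _ => abs_nonneg _) (r := fun n => 3 / 2 * |η n - ξ|)
      (by simpa using hη0.const_mul (3 / 2)) ?_
    filter_upwards [hCn, hexit] with n hn hxn
    have hG := (block_gain_bounds ha hx hC hn hT hN (hε n) (hsmall n) le_rfl).2 hxn
    set G := stoppedGain (ε n) (blockPath T N x n) (N n) / ε n ^ 2
    have hrec : w (n + 1) - ξ = (η n - ξ) + (η n - w n) * (G - 1) := by
      rw [hw, wealth]; ring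
    have h1 : |η n - w n| ≤ |η n - ξ| + |w n - ξ| := by
      rw [abs_sub_comm (w n)]; exact abs_sub_le _ _ _
    calc |w (n + 1) - ξ| ≤ |η n - ξ| + |η n - w n| * |G - 1| := by
          rw [hrec, ← abs_mul]; exact abs_add_le _ _
      _ ≤ |η n - ξ| + (|η n - ξ| + |w n - ξ|) * (1 / 2) := by gcongr
      _ = |w n - ξ| / 2 + 3 / 2 * |η n - ξ| := by ring
  refine Metric.tendsto_nhds.2 fun b hb => ?_
  have hlim : Tendsto (fun n => 3 * |w n - ξ| + 2 * |η n - ξ|) atTop (𝓝 0) := by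
    simpa using (hw0.const_mul 3).add (hη0.const_mul 2)
  obtain ⟨n₀, hn₀⟩ := eventually_atTop.1 (hCn.and (hlim.eventually_lt_const hb))
  -- Between block ends only |G| ≤ 2 is available, but it multiplies η - w, which already tends to
  -- 0.
  filter_upwards [Ioo_mem_nhdsLT (hT1 n₀)] with t ht
  obtain ⟨m, hm⟩ := exists_block hTlim ⟨(hT n₀.zero_le).trans ht.1.le, ht.2⟩
  have hmn : n₀ ≤ m := by
    by_contra hlt
    exact (hm.2.trans_le (hT (show m + 1 ≤ n₀ by omega))).not_gt ht.1
  obtain ⟨hCm, hbm⟩ := hn₀ m hmn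
  have hG := (block_gain_bounds ha hx hC hCm hT hN (hε m) (hsmall m) hm.1).1
  rw [Real.dist_eq, glsIntegral_strategy hβ0 hβ1 hβa hC hx hT hT0 hN hh ⟨hm.1, hm.2.le⟩ ht.2,
    ← hw]
  set G := stoppedGain (ε m) (stoppedBlockPath T N x t m) (N m) / ε m ^ 2
  have h1 : |η m - w m| ≤ |η m - ξ| + |w m - ξ| := by
    rw [abs_sub_comm (w m)]; exact abs_sub_le _ _ _
  calc |w m + (η m - w m) * G - ξ| = |(w m - ξ) + (η m - w m) * G| := by ring_nf
    _ ≤ |w m - ξ| + |η m - w m| * |G| := by rw [← abs_mul]; exact abs_add_le _ _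
    _ ≤ |w m - ξ| + (|η m - ξ| + |w m - ξ|) * 2 := by gcongr
    _ = 3 * |w m - ξ| + 2 * |η m - ξ| := by ring
    _ < b := hbm

end Strategy

/-! ### Choice of the parameters -/

/-- The decisive term is N(ℓ/N)^{2a}, of order N^{1-2a}; it tends to 0 precisely because a > 1/2. -/
theorem exists_fine_grid {a c ℓ ε : ℝ} (ha : 1 / 2 < a) (hℓ : 0 ≤ ℓ) (hε : 0 < ε) :
    ∃ N : ℕ, 0 < N ∧ 2 * ε * (c * (ℓ / N) ^ a) + (c * (ℓ / N) ^ a) ^ 2 +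
      N * (c * (ℓ / N) ^ a) ^ 2 ≤ ε ^ 2 / 2 := by
  have h1 : Tendsto (fun N : ℕ => c * (ℓ / N) ^ a) atTop (𝓝 0) := by
    have := (tendsto_const_div_atTop_nhds_zero_nat ℓ).rpow_const (p := a) (Or.inr (by linarith))
    rw [Real.zero_rpow (by linarith)] at this
    simpa using this.const_mul c
  have h2 : Tendsto (fun N : ℕ => N * (c * (ℓ / N) ^ a) ^ 2) atTop (𝓝 0) := by
    have h := ((tendsto_rpow_neg_atTop (show 0 < 2 * a - 1 by linarith)).comp
      tendsto_natCast_atTop_atTop).const_mul (c ^ 2 * ℓ ^ (2 * a))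
    rw [mul_zero] at h
    refine h.congr' ?_
    filter_upwards [eventually_gt_atTop 0] with N hN
    have hN' : (0 : ℝ) < N := by exact_mod_cast hN
    have e1 : (ℓ / N) ^ a * (ℓ / N) ^ a = ℓ ^ (2 * a) * (N : ℝ) ^ (-(2 * a)) := by
      rw [← Real.rpow_add_of_nonneg (by positivity) (by linarith) (by linarith), ← two_mul,
        Real.div_rpow hℓ hN'.le, Real.rpow_neg hN'.le, div_eq_mul_inv]
    have e2 : (N : ℝ) ^ (-(2 * a - 1)) = N * (N : ℝ) ^ (-(2 * a)) := by
      rw [show -(2 * a - 1) = 1 + -(2 * a) by ring, Real.rpow_add hN', Real.rpow_one]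
    simp only [Function.comp_apply]
    rw [e2]
    linear_combination (-(N * c ^ 2 : ℝ)) * e1
  have h3 : Tendsto (fun N : ℕ => 2 * ε * (c * (ℓ / N) ^ a) + (c * (ℓ / N) ^ a) ^ 2 +
      N * (c * (ℓ / N) ^ a) ^ 2) atTop (𝓝 0) := by
    simpa using ((h1.const_mul (2 * ε)).add (h1.pow 2)).add h2
  obtain ⟨N, hN, hN'⟩ := ((eventually_gt_atTop 0).and
    (h3.eventually_le_const (show 0 < ε ^ 2 / 2 by positivity))).exists
  exact ⟨N, hN, hN'⟩

/-- For a fixed interval length the exponent diverges as r → 0, so the radius can be chosen after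
the times and no rate relating the two is needed. -/
theorem exists_small_ball_radius {c α ℓ q : ℝ} (hc : 0 < c) (hα : 0 < α) (hℓ : 0 < ℓ)
    (hq : 0 < q) : ∃ r : ℝ, 0 < r ∧ r ≤ ℓ ^ α ∧ Real.exp (-(c * ℓ * r ^ (-(1 / α)))) ≤ q := by
  have h1 : Tendsto (fun r : ℝ => r ^ (-(1 / α))) (𝓝[>] 0) atTop :=
    tendsto_rpow_neg_nhdsGT_zero (by simpa using hα)
  have h2 : Tendsto (fun r : ℝ => Real.exp (-(c * ℓ * r ^ (-(1 / α))))) (𝓝[>] 0) (𝓝 0) :=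
    Real.tendsto_exp_neg_atTop_nhds_zero.comp (h1.const_mul_atTop (by positivity))
  obtain ⟨r, hr, hr'⟩ := ((h2.eventually_le_const hq).and
    (Ioc_mem_nhdsGT (Real.rpow_pos_of_pos hℓ α))).exists
  exact ⟨r, hr'.1, hr'.2, hr⟩

/-! ### Adaptedness -/

theorem processPath_hoelder {Ω : Type*} {X : I → Ω → ℝ} {ω : Ω} {a C : ℝ} (ha : 0 ≤ a)
    (hC : 0 ≤ C) (h : ∀ s t : I, |X t ω - X s ω| ≤ C * |(t : ℝ) - s| ^ a) (y z : ℝ) :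
    |processPath X ω y - processPath X ω z| ≤ C * |y - z| ^ a := by
  refine (h _ _).trans ?_
  exact mul_le_mul_of_nonneg_left (Real.rpow_le_rpow (abs_nonneg _)
    (abs_projIcc_sub_projIcc (zero_le_one' ℝ)) ha) hC

theorem measurable_stoppedCoeff {Ω : Type*} {m : MeasurableSpace Ω} {y : Ω → ℕ → ℝ} {k : ℕ}
    (ε : ℝ) (hy : ∀ j ≤ k, Measurable fun ω => y ω j) :
    Measurable fun ω => stoppedCoeff ε (y ω) k := by
  unfold stoppedCoeff
  refine Measurable.ite ?_ ((hy k le_rfl).const_mul 2) measurable_const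
  simp only [ofPred_forall]
  exact MeasurableSet.iInter fun j => MeasurableSet.iInter fun hj =>
    measurableSet_lt (hy j hj).abs measurable_const

section Adapted

variable {Ω : Type*} {m : MeasurableSpace Ω} {𝓕 : Filtration I m} {X : I → Ω → ℝ}
  {T : ℕ → ℝ} {N : ℕ → ℕ} {ε : ℕ → ℝ} {η : ℕ → Ω → ℝ}

theorem measurable_processPath (hX : Adapted 𝓕 X) {u v : ℝ} (huv : u ≤ v) :
    Measurable[𝓕 (projIcc 0 1 zero_le_one v)] fun ω => processPath X ω u :=
  (hX (projIcc 0 1 zero_le_one u)).mono (𝓕.mono (monotone_projIcc zero_le_one huv)) le_rfl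

theorem measurable_blockPath (hX : Adapted 𝓕 X) (hT : Monotone T) {n k : ℕ} {v : ℝ}
    (hv : gridPoint T N n k ≤ v) :
    Measurable[𝓕 (projIcc 0 1 zero_le_one v)] fun ω => blockPath T N (processPath X ω) n k :=
  (measurable_processPath hX hv).sub
    (measurable_processPath hX ((le_gridPoint hT n k).trans hv))

theorem measurable_stoppedCoeff_blockPath (hX : Adapted 𝓕 X) (hT : Monotone T) {n k : ℕ} {v : ℝ}
    (hv : gridPoint T N n k ≤ v) :
    Measurable[𝓕 (projIcc 0 1 zero_le_one v)]
      fun ω => stoppedCoeff (ε n) (blockPath T N (processPath X ω) n) k :=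
  measurable_stoppedCoeff (m := 𝓕 (projIcc 0 1 zero_le_one v)) _ fun _ hj =>
    measurable_blockPath hX hT ((gridPoint_mono hT n hj).trans hv)

theorem measurable_wealth (hX : Adapted 𝓕 X) (hT : Monotone T) (hN : ∀ n, 0 < N n)
    (hη : ∀ n, Measurable[𝓕 (projIcc 0 1 zero_le_one (T n))] (η n)) (n : ℕ) :
    Measurable[𝓕 (projIcc 0 1 zero_le_one (T n))]
      fun ω => wealth T N ε (fun j => η j ω) (processPath X ω) n := by
  induction n with
  | zero => exact @measurable_const _ _ _ (_) _
  | succ n ih =>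
    have hle : 𝓕 (projIcc 0 1 zero_le_one (T n)) ≤ 𝓕 (projIcc 0 1 zero_le_one (T (n + 1))) :=
      𝓕.mono (monotone_projIcc zero_le_one (hT n.le_succ))
    have h1 := ih.mono hle le_rfl
    have h2 := (hη n).mono hle le_rfl
    have h3 : Measurable[𝓕 (projIcc 0 1 zero_le_one (T (n + 1)))] fun ω =>
        stoppedGain (ε n) (blockPath T N (processPath X ω) n) (N n) := by
      unfold stoppedGain
      refine Finset.measurable_fun_sum _ fun k hk => ?_
      have hk := Finset.mem_range.1 hk
      exact (measurable_stoppedCoeff_blockPath hX hT (gridPoint_le hT hN hk.le)).mul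
        ((measurable_blockPath hX hT (gridPoint_le hT hN hk)).sub
          (measurable_blockPath hX hT (gridPoint_le hT hN hk.le)))
    exact h1.add ((h2.sub h1).mul (h3.div_const _))

/-- A cell contributes at time u only if its left end is at most u, and its coefficient depends on
the path up to that left end. -/
theorem measurable_mul_blockStrategy (hX : Adapted 𝓕 X) (hT : Monotone T) (hN : ∀ n, 0 < N n)
    (hη : ∀ n, Measurable[𝓕 (projIcc 0 1 zero_le_one (T n))] (η n)) (n : ℕ) (u : ℝ) :
    Measurable[𝓕 (projIcc 0 1 zero_le_one u)] fun ω =>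
      (η n ω - wealth T N ε (fun j => η j ω) (processPath X ω) n) *
        blockStrategy T N ε (processPath X ω) n u := by
  rcases lt_or_ge u (T n) with hu | hu
  · simp only [blockStrategy_eq_zero hT le_rfl hu, mul_zero]
    exact @measurable_const _ _ _ (_) _
  · have hle : 𝓕 (projIcc 0 1 zero_le_one (T n)) ≤ 𝓕 (projIcc 0 1 zero_le_one u) :=
      𝓕.mono (monotone_projIcc zero_le_one hu)
    refine (((hη n).mono hle le_rfl).sub
      ((measurable_wealth hX hT hN hη n).mono hle le_rfl)).mul ?_
    unfold blockStrategy
    refine Finset.measurable_fun_sum _ fun k _ => ?_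
    rcases lt_or_ge u (gridPoint T N n k) with hk | hk
    · simp only [indicator_of_notMem (fun h => hk.not_ge h.1 :
        u ∉ Ico (gridPoint T N n k) (gridPoint T N n (k + 1))), mul_zero]
      exact @measurable_const _ _ _ (_) _
    · exact ((measurable_stoppedCoeff_blockPath hX hT hk).div_const _).mul_const _

theorem adapted_strategy (hX : Adapted 𝓕 X) (hT : Monotone T) (hT1 : ∀ n, T n < 1)
    (hTlim : Tendsto T atTop (𝓝 1)) (hN : ∀ n, 0 < N n)
    (hη : ∀ n, Measurable[𝓕 (projIcc 0 1 zero_le_one (T n))] (η n)) :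
    Adapted 𝓕 fun (t : I) ω => strategy T N ε (fun j => η j ω) (processPath X ω) t := by
  intro t
  rcases t.2.2.eq_or_lt with h1 | h1
  -- At time 1 every block is over, so the series is identically zero and measurability is trivial.
  · have hzero : ∀ ω n, blockStrategy T N ε (processPath X ω) n t = 0 := fun ω n => by
      refine Finset.sum_eq_zero fun k hk => ?_
      rw [indicator_of_notMem, mul_zero]
      intro h
      have := (h.2.trans_le (gridPoint_le hT hN (Finset.mem_range.1 hk))).trans (hT1 _)
      exact this.ne h1
    simp only [strategy, hzero, mul_zero, tsum_zero]
    exact @measurable_const _ _ _ (_) _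
  · obtain ⟨M, hM⟩ : ∃ M, (t : ℝ) < T M := (hTlim.eventually_const_lt h1).exists
    simp only [strategy_eq_sum hT hM]
    refine Finset.measurable_fun_sum _ fun n _ => ?_
    have := measurable_mul_blockStrategy (ε := ε) hX hT hN hη n t
    rwa [projIcc_val] at this

end Adapted

/-! ### Adapted targets and the proof of the theorem -/

/-- An `𝓕 1`-measurable random variable is the almost sure limit of `𝓕 (t n)`-measurable ones, if
`t n` increases to `1` and the filtration is left-continuous at `1`. -/
theorem exists_adapted_approximation {Ω : Type*} {m : MeasurableSpace Ω} (P : Measure Ω)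
    [IsProbabilityMeasure P] (𝓕 : Filtration I m) (hF : LeftContinuousAtOne 𝓕) {t : ℕ → I}
    (ht : Monotone t) (htlim : Tendsto t atTop (𝓝 1)) (ht1 : ∀ n, t n < 1) {ξ : Ω → ℝ}
    (hξ : Measurable[𝓕 1] ξ) :
    ∃ η : ℕ → Ω → ℝ, (∀ n, Measurable[𝓕 (t n)] (η n)) ∧
      ∀ᵐ ω ∂P, Tendsto (fun n => η n ω) atTop (𝓝 (ξ ω)) := by
  let 𝓖 : Filtration ℕ m := ⟨fun n => 𝓕 (t n), fun _ _ h => 𝓕.mono (ht h), fun n => 𝓕.le _⟩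
  have hsup : ⨆ n, 𝓖 n = 𝓕 1 := by
    rw [← hF]
    refine le_antisymm (iSup_le fun n => le_iSup₂_of_le (t n) (ht1 n) le_rfl)
      (iSup₂_le fun s hs => ?_)
    obtain ⟨n, hn⟩ := (htlim.eventually_const_lt hs).exists
    exact le_iSup_of_le n (𝓕.mono hn.le)
  -- The arctangent makes the variable bounded, so Lévy's upward theorem applies without
  -- integrability of ξ.
  have hmeas : Measurable[𝓕 1] fun ω => Real.arctan (ξ ω) := Real.measurable_arctan.comp hξ
  have hint : Integrable (fun ω => Real.arctan (ξ ω)) P := by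
    refine Integrable.of_bound (hmeas.mono (𝓕.le 1) le_rfl).aestronglyMeasurable (Real.pi / 2)
      (ae_of_all _ fun ω => ?_)
    rw [Real.norm_eq_abs, abs_le]
    exact ⟨(Real.neg_pi_div_two_lt_arctan _).le, (Real.arctan_lt_pi_div_two _).le⟩
  have hconv := hint.tendsto_ae_condExp (ℱ := 𝓖) (by
    rw [hsup]
    exact hmeas.stronglyMeasurable)
  have htan : Measurable Real.tan := by
    rw [show Real.tan = fun y => Real.sin y / Real.cos y from funext Real.tan_eq_sin_div_cos]
    fun_prop
  -- The tangent undoes the arctangent. Only its continuity at the limit matters, and that limit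
  -- lies strictly between -π/2 and π/2.
  refine ⟨fun n ω => Real.tan ((P[fun ω => Real.arctan (ξ ω) | 𝓖 n]) ω), fun n => ?_, ?_⟩
  · exact htan.comp (stronglyMeasurable_condExp (m := 𝓖 n)).measurable
  · filter_upwards [hconv] with ω hω
    have := (Real.continuousAt_tan.2 (Real.cos_arctan_pos (ξ ω)).ne').tendsto.comp hω
    rwa [Real.tan_arctan] at this

theorem mainTheorem3 {Ω : Type*} {m : MeasurableSpace Ω} (P : Measure Ω) [IsProbabilityMeasure P]
    (𝓕 : Filtration I m) (hF : LeftContinuousAtOne 𝓕)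
    (X : I → Ω → ℝ) (hX : Adapted 𝓕 X)
    (a α : ℝ) (ha : 1 / 2 < a) (haα : a ≤ α)
    (hHolder : HasHolderPaths P X a) (hBall : SmallBall P X α)
    (ξ : Ω → ℝ) (hξ : Measurable[𝓕 1] ξ) :
    ∃ β : ℝ, 1 - a < β ∧ β < 1 ∧
      ∃ ψ : I → Ω → ℝ, Adapted 𝓕 ψ ∧
        ∀ᵐ ω ∂P,
          (∀ t ∈ Ico (0 : ℝ) 1, GLSIntegrable β 0 t (processPath ψ ω) (processPath X ω)) ∧
          Tendsto (fun t : ℝ => glsIntegral β 0 t (processPath ψ ω) (processPath X ω))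
            (𝓝[<] 1) (𝓝 (ξ ω)) := by
  obtain ⟨δ, hδ, c, hc, hball⟩ := hBall
  have hα : 0 < α := by linarith
  -- This keeps `T 0 = 1 - d` nonnegative and inside the range of the small ball estimate.
  set d := min δ 1 with hd
  have hd0 : 0 < d := lt_min hδ one_pos
  set T : ℕ → ℝ := fun n => 1 - d / (n + 1) with hTdef
  have hTs : StrictMono T := strictMono_nat_of_lt_succ fun n => by
    simp only [hTdef]
    push_cast
    gcongr
    linarith
  have hT1 : ∀ n, T n < 1 := fun n => sub_lt_self _ (by positivity)
  have hT0 : 0 ≤ T 0 := by simp [hTdef, hd]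
  have hTn : ∀ n, T n ∈ Icc (0 : ℝ) 1 := fun n =>
    ⟨hT0.trans (hTs.monotone n.zero_le), (hT1 n).le⟩
  have hTδ : ∀ n, 1 - δ ≤ T n := fun n => by
    refine le_trans ?_ (hTs.monotone n.zero_le)
    have := min_le_left δ 1
    simp only [hTdef, Nat.cast_zero, zero_add, div_one]
    linarith
  have hTlim : Tendsto T atTop (𝓝 1) := by
    have := (tendsto_one_div_add_atTop_nhds_zero_nat (𝕜 := ℝ)).const_mul d
    simpa [hTdef, div_eq_mul_inv] using this.const_sub 1
  set τ : ℕ → I := fun n => projIcc 0 1 zero_le_one (T n) with hτ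
  have hτT : ∀ n, ((τ n : I) : ℝ) = T n := fun n => by
    simp only [hτ, projIcc_of_mem zero_le_one (hTn n)]
  obtain ⟨η, hηm, hηlim⟩ := exists_adapted_approximation P 𝓕 hF (t := τ)
    (fun i j hij => monotone_projIcc zero_le_one (hTs.monotone hij))
    (tendsto_subtype_rng.2 (by simpa only [hτT, Icc.coe_one] using hTlim))
    (fun n => Subtype.coe_lt_coe.1 (by rw [hτT]; exact hT1 n)) hξ
  have hradius : ∀ n : ℕ, ∃ r : ℝ, 0 < r ∧
      P {ω | ∀ u ∈ Icc (τ n) (τ (n + 1)), |X u ω - X (τ n) ω| ≤ 2 * r} ≤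
        ENNReal.ofReal ((1 / 2) ^ n) := fun n => by
    have hlt : 0 < T (n + 1) - T n := sub_pos.2 (hTs n.lt_succ_self)
    obtain ⟨r, hr0, hrα, hr⟩ := exists_small_ball_radius hc hα hlt
      (show (0 : ℝ) < (1 / 2) ^ n by positivity)
    -- Half the radius, since the exit condition is phrased with 2ε.
    refine ⟨r / 2, by positivity, ?_⟩
    have := hball (τ n) (τ (n + 1)) (by rw [hτT]; exact hTδ n)
      (monotone_projIcc zero_le_one (hTs.monotone n.le_succ)) r hr0 (by rwa [hτT, hτT])
    rw [hτT, hτT] at this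
    rw [mul_div_cancel₀ r two_ne_zero]
    exact this.trans (ENNReal.ofReal_le_ofReal hr)
  choose ε hε hεP using hradius
  have hgrid : ∀ n : ℕ, _ := fun n => exists_fine_grid (c := n) ha
    (sub_nonneg.2 (hTs.monotone n.le_succ)) (hε n)
  choose N hN hsmall using hgrid
  -- Borel–Cantelli: the probabilities of staying in the ball are dominated by a geometric series.
  have hexit := ae_eventually_notMem (μ := P) (s := fun n =>
    {ω | ∀ u ∈ Icc (τ n) (τ (n + 1)), |X u ω - X (τ n) ω| ≤ 2 * ε n}) (by
      refine ne_top_of_le_ne_top ?_ (ENNReal.tsum_le_tsum hεP)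
      rw [← ENNReal.ofReal_tsum_of_nonneg (fun n => by positivity) summable_geometric_two]
      exact ENNReal.ofReal_ne_top)
  -- The order 1/2 is admissible because a > 1/2 gives 1 - a < 1/2.
  refine ⟨1 / 2, by linarith, by norm_num, fun t ω => strategy T N ε (fun j => η j ω)
    (processPath X ω) t, adapted_strategy hX hTs.monotone hT1 hTlim hN hηm, ?_⟩
  filter_upwards [hHolder, hηlim, hexit] with ω hC hηω hexitω
  obtain ⟨C, hC⟩ := hC
  have hC0 : 0 ≤ C := by simpa using (abs_nonneg _).trans (hC 0 1)
  have hpath := processPath_hoelder (by linarith) hC0 hC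
  have heq : EqOn (processPath (fun (t : I) ω => strategy T N ε (fun j => η j ω)
      (processPath X ω) t) ω) (strategy T N ε (fun j => η j ω) (processPath X ω)) (Ico 0 1) :=
    fun u hu => IccExtend_of_mem zero_le_one _ (Ico_subset_Icc_self hu)
  refine ⟨fun t ht => glsIntegrable_strategy (by norm_num) (by norm_num) (by linarith) hC0 hpath
    hTs.monotone hT0 hTlim heq ht, ?_⟩
  refine tendsto_glsIntegral_strategy (by norm_num) (by norm_num) (by linarith) hC0 hpath
    hTs.monotone hT0 hT1 hTlim hN hε hsmall ?_ hηω heq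
  filter_upwards [hexitω] with n hn
  simp only [not_forall, not_le] at hn
  obtain ⟨u, hu, hlt⟩ := hn
  refine ⟨u, ⟨?_, ?_⟩, ?_⟩
  · rw [← hτT]; exact hu.1
  · rw [← hτT]; exact hu.2
  · rwa [processPath, IccExtend_val, IccExtend_apply]
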